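/- Let $m,n\ge 1$, let $X$ be a complex Banach space and $E=\{(x,\vec y)\in(\mathbb R^n)^{m+1}:x=y_1=\cdots=y_m\}$. Let $Q:(\mathbb R^n)^{m+1}\setminus E\to B(\mathbb C,X)$ be a strongly measurable function satisfying, for some constant $C$, the size condition $$\|Q(x,\vec y)\|_{B(\mathbb C,X)}\le \frac{C}{\big(\sum_{j=1}^m|x-y_j|\big)^{mn}}\qquad\text{for all }(x,\vec y)\notin E .$$ **Weights.** A weight is a nonnegative locally integrable function on $\mathbb R^n$ that is positive almost everywhere; $\omega(B)=\int_B\omega\,dx$. $A_\infty=\bigcup_{1\le q<\infty}A_q$ is the union of the Muckenhoupt classes. Let $p_1,\dots,p_m\in[1,\infty)$, $\frac1p=\sum_{k}\frac1{p_k}$, and let $\vec\omega=(\omega_1,\dots,\omega_m)$ be weights, $\nu_{\vec\omega}=\prod_{i}\omega_i^{p/p_i}$. Suppose $\omega_i\in A_\infty$ for every $i$ and $\vec\omega\in A_{\vec P}$, i.e. $$\sup_B\Big(\frac1{|B|}\int_B\nu_{\vec\omega}\Big)^{1/p}\prod_{i=1}^m\Big(\frac1{|B|}\int_B\omega_i^{1-p_i'}\Big)^{1/p_i'}<\infty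 ,$$ the supremum being over all balls $B$, where for $p_i=1$ the $i$-th factor means $(\operatorname{ess\,inf}_B\omega_i)^{-1}$. **Spaces.** For $0<\kappa<1$, $q>0$ and a weight $\omega$ put $\|g\|_{L^{q,\kappa}(\omega)}=\sup_B\omega(B)^{-\kappa/q}\|g\|_{L^q(B,\omega dx)}$ and $\|g\|_{WL^{q,\kappa}(\omega)}=\sup_B\omega(B)^{-\kappa/q}\|g\|_{WL^q(B,\omega dx)}$, where $\|g\|_{WL^q(B,\omega dx)}=\sup_{\lambda>0}\lambda\,\omega(\{x\in B:|g(x)|>\lambda\})^{1/q}$; $L^{q,\kappa}(\omega)$ consists of the measurable functions with finite norm. **Operators.** For function spaces $D_1,\dots,D_m$, say that $\mathcal T$ is an operator with kernel $Q$ on $D_1\times\cdots\times D_m$ if it maps each $\vec f\in D_1\times\cdots\times D_m$ to a strongly measurable $X$-valued function $\mathcal T(\vec f)$ (up to null sets), is $m$-linear, and satisfies $$\mathcal T(\vec f)(x)=\int_{(\mathbb R^n)^m}Q(x,\vec y)\Big(\prod_{j=1}^mf_j(y_j)\Big)\,d\vec y \qquad(*)$$ with an absolutely convergent integral for almost every $x\notin\bigcap_{j}\operatorname{supp}f_j$.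 Let $\mathcal T$ be an operator with kernel $Q$ on $L^{p_1}(\omega_1)\times\cdots\times L^{p_m}(\omega_m)$, $T(\vec f)(x)=\|\mathcal T(\vec f)(x)\|_X$, and let $0<\kappa<1$. Then there is a unique operator with kernel $Q$ on $L^{p_1,\kappa}(\omega_1)\times\cdots\times L^{p_m,\kappa}(\omega_m)$ that agrees with $\mathcal T$ on all tuples with $f_i\in L^{p_i}(\omega_i)\cap L^{p_i,\kappa}(\omega_i)$; denote it again by $\mathcal T$, and its norm by $T$. If for every $\vec f\in\prod_i L^{p_i}(\omega_i)$ formula $(*)$ holds, with absolute convergence, for almost every $x\in\mathbb R^n$, then the same is true for every $\vec f\in\prod_i L^{p_i,\kappa}(\omega_i)$. Moreover: (i) If $\min_ip_i>1$ and $T$ is bounded from $L^{p_1}(\omega_1)\times\cdots\times L^{p_m}(\omega_m)$ to $L^p(\nu_{\vec\omega})$, then there is a constant $C$, independent of $\vec f$, such that $$\|T(\vec f)\|_{L^{p,\kappa}(\nu_{\vec\omega})}\le C\prod_{i=1}^m\|f_i\|_{L^{p_i,\kappa}(\omega_i)}\qquad\text{for all }f_i\in L^{p_i,\kappa}(\omega_i).$$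 (ii) If $\min_ip_i=1$ and $T$ is bounded from $L^{p_1}(\omega_1)\times\cdots\times L^{p_m}(\omega_m)$ to $WL^p(\nu_{\vec\omega})$, then there is a constant $C$, independent of $\vec f$, such that $$\|T(\vec f)\|_{WL^{p,\kappa}(\nu_{\vec\omega})}\le C\prod_{i=1}^m\|f_i\|_{L^{p_i,\kappa}(\omega_i)}\qquad\text{for all }f_i\in L^{p_i,\kappa}(\omega_i).$$ -/

import Mathlib

open MeasureTheory
open scoped ENNReal NNReal

noncomputable section

namespace MorreyMultilinear

/-- Euclidean space `ℝⁿ`. -/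
abbrev E (n : ℕ) : Type := EuclideanSpace ℝ (Fin n)

/-- A weight: nonnegative, locally integrable and positive almost everywhere. -/
structure IsWeight {n : ℕ} (w : E n → ℝ) : Prop where
  nonneg : ∀ x, 0 ≤ w x
  pos : ∀ᵐ x, 0 < w x
  locallyIntegrable : LocallyIntegrable w

/-- The weighted measure `w dx`. -/
def wMeasure {n : ℕ} (w : E n → ℝ) : Measure (E n) :=
  volume.withDensity fun x => ENNReal.ofReal (w x)

/-- The Muckenhoupt class `A_q`, `1 ≤ q < ∞`; all averages are taken in `[0, ∞]`. -/
def IsMuckenhoupt {n : ℕ} (q : ℝ) (w : E n → ℝ) : Prop :=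
  IsWeight w ∧ ∃ C : ℝ≥0, ∀ (c : E n) (r : ℝ), 0 < r →
    if q = 1 then
      (⨍⁻ x in Metric.ball c r, ENNReal.ofReal (w x) ∂volume) ≤
        C * essInf (fun x => ENNReal.ofReal (w x)) (volume.restrict (Metric.ball c r))
    else
      (⨍⁻ x in Metric.ball c r, ENNReal.ofReal (w x) ∂volume) *
        (⨍⁻ x in Metric.ball c r, ENNReal.ofReal (w x) ^ (-1 / (q - 1)) ∂volume) ^ (q - 1) ≤ C

/-- `A_∞ = ⋃_{1 ≤ q < ∞} A_q`. -/
def IsAInfty {n : ℕ} (w : E n → ℝ) : Prop :=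
  ∃ q : ℝ, 1 ≤ q ∧ IsMuckenhoupt q w

/-- `ν_w = ∏ w_i ^ (p / p_i)`. -/
def nuWeight {n m : ℕ} (P : Fin m → ℝ) (p : ℝ) (w : Fin m → E n → ℝ) : E n → ℝ :=
  fun x => ∏ i, w i x ^ (p / P i)

/-- `(1/|B| ∫_B w^{1-q'})^{1/q'}`, with `q' = q / (q - 1)`, so that `1 - q' = -1 / (q - 1)` and
`1 / q' = 1 - 1 / q`; for `q = 1` it is `(ess inf_B w)⁻¹`. -/
def dualAverage {n : ℕ} (q : ℝ) (w : E n → ℝ) (B : Set (E n)) : ℝ≥0∞ :=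
  if q = 1 then (essInf (fun x => ENNReal.ofReal (w x)) (volume.restrict B))⁻¹
  else (⨍⁻ x in B, ENNReal.ofReal (w x) ^ (-1 / (q - 1)) ∂volume) ^ (1 - 1 / q)

/-- The multiple weight condition `A_P`. -/
def IsMultipleWeight {n m : ℕ} (P : Fin m → ℝ) (p : ℝ) (w : Fin m → E n → ℝ) : Prop :=
  (∀ i, IsWeight (w i)) ∧ ∃ C : ℝ≥0, ∀ (c : E n) (r : ℝ), 0 < r →
    (⨍⁻ x in Metric.ball c r, ENNReal.ofReal (nuWeight P p w x) ∂volume) ^ (1 / p) *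
      ∏ i, dualAverage (P i) (w i) (Metric.ball c r) ≤ C

/-- The weak Lebesgue quasinorm `sup_{t > 0} t μ{|g| > t}^{1/p}`. -/
def weakLpNorm {n : ℕ} {Y : Type*} [NormedAddCommGroup Y] (p : ℝ) (g : E n → Y)
    (μ : Measure (E n)) : ℝ≥0∞ :=
  ⨆ t : ℝ≥0, (t : ℝ≥0∞) * μ {x | (t : ℝ≥0∞) < ‖g x‖ₑ} ^ (1 / p)

/-- The weighted Morrey norm `sup_B w(B)^{-κ/p} ‖g‖_{L^p(B, w dx)}`. -/
def morreyNorm {n : ℕ} {Y : Type*} [NormedAddCommGroup Y] (p κ : ℝ) (w : E n → ℝ)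
    (g : E n → Y) : ℝ≥0∞ :=
  ⨆ (c : E n) (r : ℝ) (_ : 0 < r),
    wMeasure w (Metric.ball c r) ^ (-κ / p) *
      eLpNorm g (ENNReal.ofReal p) ((wMeasure w).restrict (Metric.ball c r))

/-- The weighted weak Morrey norm `sup_B w(B)^{-κ/p} ‖g‖_{WL^p(B, w dx)}`. -/
def weakMorreyNorm {n : ℕ} {Y : Type*} [NormedAddCommGroup Y] (p κ : ℝ) (w : E n → ℝ)
    (g : E n → Y) : ℝ≥0∞ :=
  ⨆ (c : E n) (r : ℝ) (_ : 0 < r),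
    wMeasure w (Metric.ball c r) ^ (-κ / p) *
      weakLpNorm p g ((wMeasure w).restrict (Metric.ball c r))

/-- The functions in `L^p(w)`. -/
def lebesgueClass {n : ℕ} (p : ℝ) (w : E n → ℝ) : Set (E n → ℂ) :=
  {f | MemLp f (ENNReal.ofReal p) (wMeasure w)}

/-- The functions in `L^{p,κ}(w)`. -/
def morreyClass {n : ℕ} (p κ : ℝ) (w : E n → ℝ) : Set (E n → ℂ) :=
  {f | AEStronglyMeasurable f volume ∧ morreyNorm p κ w f < ∞}

section Operators

variable {n m : ℕ} {X : Type*} [NormedAddCommGroup X] [NormedSpace ℂ X]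

/-- The size condition on `Q`, off the diagonal `x = y_1 = ⋯ = y_m`. -/
def SizeCondition (Q : E n → (Fin m → E n) → (ℂ →L[ℂ] X)) : Prop :=
  ∃ C : ℝ, ∀ (x : E n) (y : Fin m → E n), (∃ j, y j ≠ x) →
    ‖Q x y‖ ≤ C / (∑ j, ‖x - y j‖) ^ (m * n)

/-- The integrand `Q(x, y)(∏ f_j(y_j))`. -/
def integrand (Q : E n → (Fin m → E n) → (ℂ →L[ℂ] X)) (f : Fin m → E n → ℂ) (x : E n) :
    (Fin m → E n) → X :=
  fun y => Q x y (∏ j, f j (y j))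

/-- The vector `v` is the value `∫ Q(x, y)(∏ f_j(y_j)) dy`, as an absolutely convergent
integral. -/
def IsIntegralValue (Q : E n → (Fin m → E n) → (ℂ →L[ℂ] X)) (f : Fin m → E n → ℂ)
    (x : E n) (v : X) : Prop :=
  Integrable (integrand Q f x) volume ∧ v = ∫ y, integrand Q f x y

/-- `T` is a well-defined `m`-linear operator on `D_1 × ⋯ × D_m`, with values in the measurable
`X`-valued functions modulo null sets, which is given by the kernel `Q`: the integral formula
holds at almost every `x` outside `⋂ supp f_j`.
(For singular kernels the integral does not converge inside the supports.) -/
structure IsKernelOperator (Q : E n → (Fin m → E n) → (ℂ →L[ℂ] X))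
    (D : Fin m → Set (E n → ℂ)) (T : (Fin m → E n → ℂ) → E n → X) : Prop where
  aestronglyMeasurable : ∀ f, (∀ i, f i ∈ D i) → AEStronglyMeasurable (T f) volume
  map_add : ∀ f, (∀ i, f i ∈ D i) → ∀ i, ∀ g ∈ D i, ∀ h ∈ D i,
    ∀ᵐ x, T (Function.update f i (g + h)) x =
      T (Function.update f i g) x + T (Function.update f i h) x
  map_smul : ∀ f, (∀ i, f i ∈ D i) → ∀ i, ∀ g ∈ D i, ∀ a : ℂ,
    ∀ᵐ x, T (Function.update f i (a • g)) x = a • T (Function.update f i g) x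
  integral_formula : ∀ f, (∀ i, f i ∈ D i) →
    ∀ᵐ x, x ∉ ⋂ i, tsupport (f i) → IsIntegralValue Q f x (T f x)

/-- `T'` is an operator with kernel `Q` on `D'_1 × ⋯ × D'_m` that coincides with `T` on the
tuples in both domains. -/
def IsKernelExtension (Q : E n → (Fin m → E n) → (ℂ →L[ℂ] X))
    (D D' : Fin m → Set (E n → ℂ)) (T T' : (Fin m → E n → ℂ) → E n → X) : Prop :=
  IsKernelOperator Q D' T' ∧
    ∀ f, (∀ i, f i ∈ D i) → (∀ i, f i ∈ D' i) → T' f =ᵐ[volume] T f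

/-- `T` is given by the absolutely convergent integral formula almost everywhere. -/
def IsIntegralOperator (Q : E n → (Fin m → E n) → (ℂ →L[ℂ] X))
    (D : Fin m → Set (E n → ℂ)) (T : (Fin m → E n → ℂ) → E n → X) : Prop :=
  ∀ f, (∀ i, f i ∈ D i) → ∀ᵐ x, IsIntegralValue Q f x (T f x)

end Operators

end MorreyMultilinear

end

/-! Fix a ball `B` of radius `r` and split each tuple into its truncation to `2B` and the rest.
Write `ν` for the product weight. Everything reduces to two estimates in terms of `ν(B)`.

Local part: the assumed bound for `T` applies to the truncated tuple. The product of the norms over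
`2B` is at most the product of the Morrey norms times `∏ w_i(2B)^(κ/p_i)`. Hölder's inequality and
the `A_∞` conditions give `∏ w_i(B)^(p/p_i) ≤ C ν(B)` (`exists_prod_wMeasure_ball_rpow_le`), and `ν`
is doubling, so this is at most `C ν(B)^(κ/p)`.

Tail (`exists_lintegral_integrand_sub_le`): for `x ∈ B` and `y` not entirely in `2B`, sort `y` by
the dyadic size of its farthest coordinate. At scale `k` the kernel bound cancels the volume of the
product of balls, and Hölder with `A_P` leaves `C ν(2^(k+2) B)^((κ-1)/p)`. As `κ < 1`, reverse
doubling of `ν` makes this a geometric series with sum at most `C ν(B)^((κ-1)/p)`, uniformly on `B`.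
Integration over `B` contributes `ν(B)^(1/p)`, which restores `ν(B)^(κ/p)`.

The same tail bound makes the extension meaningful: on `B` put `T` of the truncation plus the
convergent tail integral. By multilinearity and the kernel formula, enlarging the truncation changes
`T` by exactly the integral removed from the tail (`IsKernelOperator.ae_truncate_eq`), so the choice
of ball does not matter. Any other extension satisfies the same identity, whence uniqueness. -/

open MeasureTheory
open scoped ENNReal NNReal

noncomputable section

namespace MorreyMultilinear

/-! ### A Hölder inequality bounding products of averages from below. -/

section Holder

variable {α ι : Type*} [MeasurableSpace α] [Fintype ι]

/-- Hölder's inequality for `1 = V ^ a * ∏ (W i ^ (-1 / s i)) ^ (a * s i * θ i)`, where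
`V = ∏ W i ^ θ i`. -/
theorem one_le_lintegral_mul_prod_lintegral_rpow {μ : Measure α} [IsProbabilityMeasure μ]
    {W : ι → α → ℝ≥0∞} {V : α → ℝ≥0∞} {θ s : ι → ℝ}
    (hW : ∀ i, AEMeasurable (W i) μ) (hW0 : ∀ᵐ x ∂μ, ∀ i, W i x ≠ 0 ∧ W i x ≠ ∞)
    (hV : ∀ᵐ x ∂μ, V x = ∏ i, W i x ^ θ i) (hθ : ∀ i, 0 ≤ θ i) (hs : ∀ i, 0 < s i) :
    1 ≤ (∫⁻ x, V x ∂μ) * ∏ i, (∫⁻ x, W i x ^ (-1 / s i) ∂μ) ^ (s i * θ i) := by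
  have hVm : AEMeasurable V μ := by
    refine AEMeasurable.congr (f := fun x => ∏ i, W i x ^ θ i) ?_ (hV.mono fun x hx => hx.symm)
    exact Finset.aemeasurable_fun_prod _ fun i _ => (hW i).pow_const _
  -- Dividing by `b` makes the Hölder exponents `1 / b` and `s i * θ i / b` sum to one; the power
  -- `b` is taken back at the end.
  set b : ℝ := 1 + ∑ i, s i * θ i with hb
  have hb0 : 0 < b := by
    have : 0 ≤ ∑ i, s i * θ i := Finset.sum_nonneg fun i _ => mul_nonneg (hs i).le (hθ i)
    linarith
  have key := ENNReal.lintegral_mul_prod_norm_pow_le (μ := μ) Finset.univ hVm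
    (f := fun i x => W i x ^ (-1 / s i)) (fun i _ => (hW i).pow_const _) (1 / b)
    (p := fun i => s i * θ i / b) (by rw [← Finset.sum_div, ← add_div]; exact div_self hb0.ne')
    (by positivity) (fun i _ => div_nonneg (mul_nonneg (hs i).le (hθ i)) hb0.le)
  have hone : ∫⁻ x, V x ^ (1 / b) * ∏ i, (W i x ^ (-1 / s i)) ^ (s i * θ i / b) ∂μ = 1 := by
    rw [show (1 : ℝ≥0∞) = ∫⁻ _, 1 ∂μ by simp]
    refine lintegral_congr_ae ?_
    filter_upwards [hW0, hV] with x hx hVx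
    rw [hVx, ← ENNReal.prod_rpow_of_nonneg (by positivity), ← Finset.prod_mul_distrib]
    refine Finset.prod_eq_one fun i _ => ?_
    rw [← ENNReal.rpow_mul, ← ENNReal.rpow_mul, ← ENNReal.rpow_add _ _ (hx i).1 (hx i).2]
    have : θ i * (1 / b) + -1 / s i * (s i * θ i / b) = 0 := by
      have := (hs i).ne'
      field_simp
      ring
    rw [this, ENNReal.rpow_zero]
  rw [hone] at key
  have := ENNReal.rpow_le_rpow key hb0.le
  rw [ENNReal.one_rpow, ENNReal.mul_rpow_of_nonneg _ _ hb0.le,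
    ← ENNReal.prod_rpow_of_nonneg hb0.le, ← ENNReal.rpow_mul, one_div_mul_cancel hb0.ne',
    ENNReal.rpow_one] at this
  refine this.trans_eq ?_
  congr 1
  refine Finset.prod_congr rfl fun i _ => ?_
  rw [← ENNReal.rpow_mul, div_mul_cancel₀ _ hb0.ne']

theorem prod_rpow_eq_rpow_sum {x : ℝ≥0∞} (h0 : x ≠ 0) (h : x ≠ ∞) (a : ι → ℝ) :
    ∏ i, x ^ a i = x ^ ∑ i, a i := by
  classical
  induction (Finset.univ : Finset ι) using Finset.induction_on with
  | empty => simp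
  | insert i s hi ih =>
    rw [Finset.prod_insert hi, Finset.sum_insert hi, ih, ENNReal.rpow_add _ _ h0 h]

end Holder

/-! ### Weights on balls and the Muckenhoupt condition. -/

variable {n m : ℕ}

theorem volume_ball_pos_ne (c : E n) {r : ℝ} (hr : 0 < r) :
    volume (Metric.ball c r) ≠ 0 ∧ volume (Metric.ball c r) ≠ ∞ :=
  ⟨(Metric.measure_ball_pos _ _ hr).ne', measure_ball_lt_top.ne⟩

theorem isProbabilityMeasure_ball (c : E n) {r : ℝ} (hr : 0 < r) :
    IsProbabilityMeasure
      ((volume.restrict (Metric.ball c r) Set.univ)⁻¹ • volume.restrict (Metric.ball c r)) := by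
  constructor
  have := volume_ball_pos_ne c hr
  simp only [Measure.restrict_apply_univ, Measure.smul_apply, smul_eq_mul]
  exact ENNReal.inv_mul_cancel this.1 this.2

theorem IsWeight.aemeasurable {w : E n → ℝ} (hw : IsWeight w) :
    AEMeasurable (fun x => ENNReal.ofReal (w x)) volume :=
  hw.locallyIntegrable.aestronglyMeasurable.aemeasurable.ennreal_ofReal

theorem IsWeight.ae_ne {w : E n → ℝ} (hw : IsWeight w) :
    ∀ᵐ x, ENNReal.ofReal (w x) ≠ 0 ∧ ENNReal.ofReal (w x) ≠ ∞ :=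
  hw.pos.mono fun x hx => ⟨by simpa using hx, ENNReal.ofReal_ne_top⟩

theorem wMeasure_apply_ball (w : E n → ℝ) (c : E n) (r : ℝ) :
    wMeasure w (Metric.ball c r) = ∫⁻ x in Metric.ball c r, ENNReal.ofReal (w x) :=
  withDensity_apply _ measurableSet_ball

theorem wMeasure_absolutelyContinuous (w : E n → ℝ) : wMeasure w ≪ volume :=
  withDensity_absolutelyContinuous _ _

theorem wMeasure_ball_eq_volume_mul (w : E n → ℝ) (c : E n) {r : ℝ} (hr : 0 < r) :
    wMeasure w (Metric.ball c r) =
      volume (Metric.ball c r) * ⨍⁻ x in Metric.ball c r, ENNReal.ofReal (w x) ∂volume := by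
  have := volume_ball_pos_ne c hr
  rw [wMeasure_apply_ball, setLAverage_eq, ENNReal.mul_div_cancel this.1 this.2]

theorem lintegral_ball_ne_zero {F : E n → ℝ≥0∞} (hF : AEMeasurable F volume)
    (hF0 : ∀ᵐ x, F x ≠ 0) (c : E n) {r : ℝ} (hr : 0 < r) :
    ∫⁻ x in Metric.ball c r, F x ≠ 0 := by
  intro h
  rw [lintegral_eq_zero_iff' hF.restrict] at h
  have : ∀ᵐ x ∂volume.restrict (Metric.ball c r), False := by
    filter_upwards [h, ae_restrict_of_ae hF0] with x h1 h2 using h2 h1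
  rw [Filter.eventually_false_iff_eq_bot, ae_eq_bot, Measure.restrict_eq_zero] at this
  exact (volume_ball_pos_ne c hr).1 this

theorem laverage_ball_ne_zero {F : E n → ℝ≥0∞} (hF : AEMeasurable F volume)
    (hF0 : ∀ᵐ x, F x ≠ 0) (c : E n) {r : ℝ} (hr : 0 < r) :
    ⨍⁻ x in Metric.ball c r, F x ∂volume ≠ 0 := by
  rw [setLAverage_eq]
  exact ENNReal.div_ne_zero.2 ⟨lintegral_ball_ne_zero hF hF0 c hr, (volume_ball_pos_ne c hr).2⟩

theorem IsWeight.wMeasure_ball_ne_zero {w : E n → ℝ} (hw : IsWeight w) (c : E n) {r : ℝ}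
    (hr : 0 < r) : wMeasure w (Metric.ball c r) ≠ 0 := by
  rw [wMeasure_apply_ball]
  exact lintegral_ball_ne_zero hw.aemeasurable (hw.ae_ne.mono fun _ h => h.1) c hr

theorem IsWeight.wMeasure_ball_ne_top {w : E n → ℝ} (hw : IsWeight w) (c : E n) (r : ℝ) :
    wMeasure w (Metric.ball c r) ≠ ∞ := by
  rw [wMeasure_apply_ball]
  have : IntegrableOn w (Metric.ball c r) :=
    (hw.locallyIntegrable.integrableOn_isCompact (isCompact_closedBall c r)).mono_set
      Metric.ball_subset_closedBall
  refine ne_of_lt (lt_of_le_of_lt (lintegral_mono fun x => ?_) this.2)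
  exact Real.ofReal_le_enorm (w x)

theorem laverage_inv_le_inv_essInf {w : E n → ℝ} (c : E n) {r : ℝ} (hr : 0 < r) :
    ⨍⁻ x in Metric.ball c r, ENNReal.ofReal (w x) ^ (-1 : ℝ) ∂volume ≤
      (essInf (fun x => ENNReal.ofReal (w x)) (volume.restrict (Metric.ball c r)))⁻¹ := by
  have h := volume_ball_pos_ne c hr
  rw [setLAverage_eq]
  refine ENNReal.div_le_of_le_mul ?_
  calc _ ≤ ∫⁻ _ in Metric.ball c r,
        (essInf (fun x => ENNReal.ofReal (w x)) (volume.restrict (Metric.ball c r)))⁻¹ := by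
        refine lintegral_mono_ae ?_
        filter_upwards [ae_essInf_le (f := fun x => ENNReal.ofReal (w x))
          (μ := volume.restrict (Metric.ball c r))] with x hx
        rw [ENNReal.rpow_neg_one]
        exact ENNReal.inv_le_inv.2 hx
    _ = _ := by simp

/-- Every `A_∞` weight satisfies an `A_{s+1}` condition with `s > 0`. -/
theorem IsAInfty.exists_laverage_mul_le {w : E n → ℝ} (hw : IsAInfty w) :
    ∃ (s : ℝ) (C : ℝ≥0), 0 < s ∧ ∀ (c : E n) (r : ℝ), 0 < r →
      (⨍⁻ x in Metric.ball c r, ENNReal.ofReal (w x) ∂volume) *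
        (⨍⁻ x in Metric.ball c r, ENNReal.ofReal (w x) ^ (-1 / s) ∂volume) ^ s ≤ C := by
  obtain ⟨q, hq, -, C, hC⟩ := hw
  by_cases hq1 : q = 1
  -- `A_1` is contained in `A_2`, because the average of `w⁻¹` is at most the inverse of the
  -- essential infimum; hence `s = 1`.
  · refine ⟨1, C, one_pos, fun c r hr => ?_⟩
    have h := hC c r hr
    rw [if_pos hq1] at h
    rw [ENNReal.rpow_one, div_one]
    refine (mul_le_mul' h (laverage_inv_le_inv_essInf c hr)).trans ?_
    rw [mul_assoc]
    exact mul_le_of_le_one_right' (ENNReal.mul_inv_le_one _)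
  · refine ⟨q - 1, C, sub_pos.2 (lt_of_le_of_ne hq (Ne.symm hq1)), fun c r hr => ?_⟩
    simpa only [if_neg hq1] using hC c r hr

/-! ### The product weight: comparison with its factors, doubling and reverse doubling. -/

section MultipleWeight

variable {P : Fin m → ℝ} {p : ℝ} {w : Fin m → E n → ℝ}

theorem exponent_pos (hm : 0 < m) (hP : ∀ i, 1 ≤ P i) (hp : 1 / p = ∑ i, 1 / P i) : 0 < p := by
  have : 0 < 1 / p := by
    rw [hp]
    exact Finset.sum_pos (fun i _ => by have := hP i; positivity) ⟨⟨0, hm⟩, Finset.mem_univ _⟩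
  simpa using this

theorem ofReal_nuWeight (hp : 0 < p) (hP : ∀ i, 1 ≤ P i) (hw : ∀ i, IsWeight (w i)) (x : E n) :
    ENNReal.ofReal (nuWeight P p w x) = ∏ i, ENNReal.ofReal (w i x) ^ (p / P i) := by
  rw [nuWeight, ENNReal.ofReal_prod_of_nonneg fun i _ => Real.rpow_nonneg ((hw i).nonneg x) _]
  refine Finset.prod_congr rfl fun i _ => ?_
  have := hP i
  rw [ENNReal.ofReal_rpow_of_nonneg ((hw i).nonneg x) (by positivity)]

theorem aemeasurable_nuWeight (hp : 0 < p) (hP : ∀ i, 1 ≤ P i) (hw : ∀ i, IsWeight (w i)) :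
    AEMeasurable (fun x => ENNReal.ofReal (nuWeight P p w x)) volume := by
  simp_rw [ofReal_nuWeight hp hP hw]
  exact Finset.aemeasurable_fun_prod _ fun i _ => (hw i).aemeasurable.pow_const _

theorem nuWeight_ae_ne_zero (hp : 0 < p) (hP : ∀ i, 1 ≤ P i) (hw : ∀ i, IsWeight (w i)) :
    ∀ᵐ x, ENNReal.ofReal (nuWeight P p w x) ≠ 0 := by
  filter_upwards [ae_all_iff.2 fun i => (hw i).ae_ne] with x hx
  rw [ofReal_nuWeight hp hP hw]
  refine Finset.prod_ne_zero_iff.2 fun i _ => ?_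
  exact (ENNReal.rpow_pos (pos_iff_ne_zero.2 (hx i).1) (hx i).2).ne'

/-- The exponents `s i` stay free because two choices are needed: those of the `A_∞` conditions, for
the comparison of `ν` with the factors, and `P i - 1`, for doubling. -/
theorem one_le_laverage_nuWeight_mul_prod (hp : 0 < p) (hP : ∀ i, 1 ≤ P i)
    (hw : ∀ i, IsWeight (w i)) {s : Fin m → ℝ} (hs : ∀ i, 0 < s i) (c : E n) {r : ℝ}
    (hr : 0 < r) :
    1 ≤ (⨍⁻ x in Metric.ball c r, ENNReal.ofReal (nuWeight P p w x) ∂volume) *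
      ∏ i, (⨍⁻ x in Metric.ball c r, ENNReal.ofReal (w i x) ^ (-1 / s i) ∂volume) ^
        (s i * (p / P i)) := by
  have := isProbabilityMeasure_ball c hr
  have hac : ((volume.restrict (Metric.ball c r) Set.univ)⁻¹ •
      volume.restrict (Metric.ball c r)) ≪ (volume : Measure (E n)) :=
    (Measure.smul_absolutelyContinuous).trans Measure.restrict_le_self.absolutelyContinuous
  refine one_le_lintegral_mul_prod_lintegral_rpow
    (W := fun i x => ENNReal.ofReal (w i x)) (fun i => (hw i).aemeasurable.mono_ac hac)
    (hac.ae_le (ae_all_iff.2 fun i => (hw i).ae_ne))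
    (Filter.Eventually.of_forall fun x => ofReal_nuWeight hp hP hw x)
    (fun i => ?_) hs
  have := hP i
  positivity

/-- The reverse Hölder type inequality `∏ w_i(B) ^ (p / p_i) ≤ C ν(B)` for `A_∞` weights. -/
theorem exists_prod_wMeasure_ball_rpow_le (hm : 0 < m) (hP : ∀ i, 1 ≤ P i)
    (hp : 1 / p = ∑ i, 1 / P i) (hw : ∀ i, IsWeight (w i)) (hw' : ∀ i, IsAInfty (w i)) :
    ∃ C : ℝ≥0, ∀ (c : E n) (r : ℝ), 0 < r →
      ∏ i, wMeasure (w i) (Metric.ball c r) ^ (p / P i) ≤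
        C * wMeasure (nuWeight P p w) (Metric.ball c r) := by
  have hp0 := exponent_pos hm hP hp
  choose s C hs hC using fun i => (hw' i).exists_laverage_mul_le
  have hθ : ∀ i, 0 ≤ p / P i := fun i => by have := hP i; positivity
  have hsum : ∑ i, p / P i = 1 := by
    simp_rw [div_eq_mul_one_div p]
    rw [← Finset.mul_sum, ← hp, mul_one_div_cancel hp0.ne']
  refine ⟨∏ i, C i ^ (p / P i), fun c r hr => ?_⟩
  have hvol := volume_ball_pos_ne c hr
  have h1 := one_le_laverage_nuWeight_mul_prod hp0 hP hw hs c hr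
  simp_rw [fun w => wMeasure_ball_eq_volume_mul (n := n) w c hr]
  simp_rw [ENNReal.mul_rpow_of_nonneg _ _ (hθ _)]
  rw [Finset.prod_mul_distrib]
  have hvolprod : ∏ i, volume (Metric.ball c r) ^ (p / P i) = volume (Metric.ball c r) := by
    rw [prod_rpow_eq_rpow_sum hvol.1 hvol.2, hsum, ENNReal.rpow_one]
  rw [hvolprod, mul_left_comm]
  gcongr
  -- After multiplication by the quantity that is at least one, each average of `w i` meets its own
  -- dual average, and their product is controlled by `C i`.
  refine (le_mul_of_one_le_right' h1).trans ?_
  rw [mul_left_comm, mul_comm, ← Finset.prod_mul_distrib, ENNReal.ofNNReal_finsetProd]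
  gcongr with i
  rw [ENNReal.rpow_mul, ← ENNReal.mul_rpow_of_nonneg _ _ (hθ i),
    ENNReal.coe_rpow_of_nonneg _ (hθ i)]
  exact ENNReal.rpow_le_rpow (hC i c r hr) (hθ i)

/-- This is the lower counterpart of the `A_P` bound: Hölder with `s i = P i - 1`, raised to the
power `1 / p`. For `P i = 1` the choice `s i = 1` works, as the average of `w⁻¹` is dominated by the
inverse essential infimum. -/
theorem one_le_laverage_nuWeight_rpow_mul_prod_dualAverage (hp : 0 < p) (hP : ∀ i, 1 ≤ P i)
    (hw : ∀ i, IsWeight (w i)) (c : E n) {r : ℝ} (hr : 0 < r) :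
    1 ≤ (⨍⁻ x in Metric.ball c r, ENNReal.ofReal (nuWeight P p w x) ∂volume) ^ (1 / p) *
      ∏ i, dualAverage (P i) (w i) (Metric.ball c r) := by
  have h1 := one_le_laverage_nuWeight_mul_prod hp hP hw
    (s := fun i => if P i = 1 then 1 else P i - 1) (fun i => by
      have := hP i
      split_ifs with h
      · exact one_pos
      · exact sub_pos.2 (lt_of_le_of_ne this (Ne.symm h))) c hr
  have h2 := ENNReal.rpow_le_rpow h1 (one_div_nonneg.2 hp.le)
  rw [ENNReal.one_rpow, ENNReal.mul_rpow_of_nonneg _ _ (one_div_nonneg.2 hp.le),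
    ← ENNReal.prod_rpow_of_nonneg (one_div_nonneg.2 hp.le)] at h2
  refine h2.trans ?_
  gcongr with i
  rw [← ENNReal.rpow_mul, dualAverage]
  have := hP i
  split_ifs with h
  · simp only [h, div_one, one_mul, mul_one_div_cancel hp.ne', ENNReal.rpow_one]
    exact laverage_inv_le_inv_essInf c hr
  · refine le_of_eq ?_
    congr 1
    field_simp

theorem dualAverage_ne_zero {q : ℝ} {w : E n → ℝ} (hq : 1 ≤ q) (hw : IsWeight w) (c : E n)
    {r : ℝ} (hr : 0 < r) : dualAverage q w (Metric.ball c r) ≠ 0 := by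
  rw [dualAverage]
  have hpow : ∀ a : ℝ, ⨍⁻ x in Metric.ball c r, ENNReal.ofReal (w x) ^ a ∂volume ≠ 0 := fun a =>
    laverage_ball_ne_zero (hw.aemeasurable.pow_const _)
      (hw.ae_ne.mono fun x hx => (ENNReal.rpow_pos (pos_iff_ne_zero.2 hx.1) hx.2).ne') c hr
  split_ifs with h
  · intro h0
    have := laverage_inv_le_inv_essInf (w := w) c hr
    rw [h0] at this
    exact hpow _ (nonpos_iff_eq_zero.1 this)
  · have : 0 ≤ 1 - 1 / q := by rw [sub_nonneg, div_le_one₀ (by linarith)]; exact hq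
    intro h0
    rcases ENNReal.rpow_eq_zero_iff.1 h0 with h' | h'
    · exact hpow _ h'.1
    · linarith [h'.2]

theorem dualAverage_le_of_subset {q : ℝ} {w : E n → ℝ} (hq : 1 ≤ q) {c c' : E n} {r r' : ℝ}
    (hr : 0 < r) (hr' : 0 < r') (h : Metric.ball c r ⊆ Metric.ball c' r') :
    dualAverage q w (Metric.ball c r) ≤
      (volume (Metric.ball c' r') / volume (Metric.ball c r)) ^ (1 - 1 / q) *
        dualAverage q w (Metric.ball c' r') := by
  rw [dualAverage, dualAverage]
  split_ifs with hq1
  · simp only [hq1, div_one, sub_self, ENNReal.rpow_zero, one_mul, ENNReal.inv_le_inv]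
    exact essInf_antitone_measure (Measure.restrict_mono h le_rfl).absolutelyContinuous
  · have hq0 : 0 ≤ 1 - 1 / q := by rw [sub_nonneg, div_le_one₀ (by linarith)]; exact hq
    rw [← ENNReal.mul_rpow_of_nonneg _ _ hq0]
    refine ENNReal.rpow_le_rpow ?_ hq0
    have hv := volume_ball_pos_ne c hr
    have hv' := volume_ball_pos_ne c' hr'
    rw [setLAverage_eq, setLAverage_eq]
    refine (ENNReal.div_le_div_right (lintegral_mono_set h) _).trans_eq ?_
    rw [ENNReal.div_eq_inv_mul, ENNReal.div_eq_inv_mul, ENNReal.div_eq_inv_mul,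
      show ∀ a b x y : ℝ≥0∞, a * b * (x * y) = a * ((b * x) * y) by intros; ring,
      ENNReal.mul_inv_cancel hv'.1 hv'.2, one_mul]

theorem volume_ball_eq_mul (c c' : E n) (r : ℝ) {a : ℝ} (ha : 0 < a) :
    volume (Metric.ball c (a * r)) = ENNReal.ofReal (a ^ n) * volume (Metric.ball c' r) := by
  rw [Measure.addHaar_ball_mul_of_pos _ _ ha, Measure.addHaar_ball_center _ c']
  simp

theorem wMeasure_nuWeight_ball_ne_zero (hp : 0 < p) (hP : ∀ i, 1 ≤ P i)
    (hw : ∀ i, IsWeight (w i)) (c : E n) {r : ℝ} (hr : 0 < r) :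
    wMeasure (nuWeight P p w) (Metric.ball c r) ≠ 0 := by
  rw [wMeasure_apply_ball]
  exact lintegral_ball_ne_zero (aemeasurable_nuWeight hp hP hw) (nuWeight_ae_ne_zero hp hP hw) c hr

/-- Since the dual averages do not vanish, an infinite average of `ν` would make the `A_P` product
infinite. -/
theorem IsMultipleWeight.wMeasure_nuWeight_ball_ne_top (hp : 0 < p) (hP : ∀ i, 1 ≤ P i)
    (hw : IsMultipleWeight P p w) (c : E n) {r : ℝ} (hr : 0 < r) :
    wMeasure (nuWeight P p w) (Metric.ball c r) ≠ ∞ := by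
  obtain ⟨hw, C, hC⟩ := hw
  rw [wMeasure_ball_eq_volume_mul _ _ hr]
  refine ENNReal.mul_ne_top (volume_ball_pos_ne c hr).2 fun h => ?_
  have := hC c r hr
  rw [h, ENNReal.top_rpow_of_pos (by positivity), ENNReal.top_mul] at this
  · exact absurd this (by simp)
  · exact Finset.prod_ne_zero_iff.2 fun i _ => dualAverage_ne_zero (hP i) (hw i) c hr

/-- The product weight of an `A_P` tuple is doubling. -/
theorem IsMultipleWeight.exists_doubling (hp : 0 < p) (hP : ∀ i, 1 ≤ P i)
    (hw : IsMultipleWeight P p w) :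
    ∃ D : ℝ≥0∞, D ≠ ∞ ∧ ∀ (c c' : E n) (r : ℝ), 0 < r →
      Metric.ball c r ⊆ Metric.ball c' (4 * r) →
      wMeasure (nuWeight P p w) (Metric.ball c' (4 * r)) ≤
        D * wMeasure (nuWeight P p w) (Metric.ball c r) := by
  obtain ⟨hw, C, hC⟩ := hw
  set K : ℝ≥0∞ := ENNReal.ofReal (4 ^ n) with hK
  have hq0 : ∀ i, 0 ≤ 1 - 1 / P i := fun i => by
    have := hP i
    rw [sub_nonneg, div_le_one₀ (by linarith)]; exact this
  -- `K` is the ratio of the volumes of the two balls; the second factor comes from `h1` below,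
  -- raised to the power `p`.
  refine ⟨K * ((∏ i, K ^ (1 - 1 / P i)) * C) ^ p, ?_, fun c c' r hr hsub => ?_⟩
  · refine ENNReal.mul_ne_top ENNReal.ofReal_ne_top (ENNReal.rpow_ne_top_of_nonneg hp.le
      (ENNReal.mul_ne_top (ENNReal.prod_ne_top fun i _ => ?_) ENNReal.coe_ne_top))
    exact ENNReal.rpow_ne_top_of_nonneg (hq0 i) ENNReal.ofReal_ne_top
  have hr4 : 0 < 4 * r := by positivity
  have hv := volume_ball_pos_ne c hr
  have hratio : volume (Metric.ball c' (4 * r)) / volume (Metric.ball c r) = K := by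
    rw [volume_ball_eq_mul c' c r (by norm_num), ENNReal.mul_div_cancel_right hv.1 hv.2]
  rw [wMeasure_ball_eq_volume_mul _ _ hr4, wMeasure_ball_eq_volume_mul _ _ hr,
    volume_ball_eq_mul c' c r (by norm_num)]
  set a := ⨍⁻ x in Metric.ball c r, ENNReal.ofReal (nuWeight P p w x) ∂volume
  set a' := ⨍⁻ x in Metric.ball c' (4 * r), ENNReal.ofReal (nuWeight P p w x) ∂volume
  -- Insert the lower bound on the small ball, enlarge its dual averages to the big ball, and apply
  -- `A_P` there.
  have h1 : a' ^ (1 / p) ≤ a ^ (1 / p) * ((∏ i, K ^ (1 - 1 / P i)) * C) := by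
    calc a' ^ (1 / p)
        ≤ a' ^ (1 / p) * (a ^ (1 / p) * ∏ i, dualAverage (P i) (w i) (Metric.ball c r)) :=
          le_mul_of_one_le_right'
            (one_le_laverage_nuWeight_rpow_mul_prod_dualAverage hp hP hw c hr)
      _ ≤ a' ^ (1 / p) * (a ^ (1 / p) * ∏ i, (K ^ (1 - 1 / P i) *
            dualAverage (P i) (w i) (Metric.ball c' (4 * r)))) := by
          gcongr with i
          rw [← hratio]
          exact dualAverage_le_of_subset (hP i) hr hr4 hsub
      _ = a ^ (1 / p) * ((∏ i, K ^ (1 - 1 / P i)) * (a' ^ (1 / p) *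
            ∏ i, dualAverage (P i) (w i) (Metric.ball c' (4 * r)))) := by
          rw [Finset.prod_mul_distrib]; ring
      _ ≤ _ := by
          gcongr
          exact hC c' _ hr4
  have h2 := ENNReal.rpow_le_rpow h1 hp.le
  rw [ENNReal.mul_rpow_of_nonneg _ _ hp.le, ← ENNReal.rpow_mul, ← ENNReal.rpow_mul,
    one_div_mul_cancel hp.ne', ENNReal.rpow_one, ENNReal.rpow_one] at h2
  calc K * volume (Metric.ball c r) * a'
      ≤ K * volume (Metric.ball c r) * (a * ((∏ i, K ^ (1 - 1 / P i)) * C) ^ p) := by gcongr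
    _ = _ := by ring

/-- The annulus between radii `r` and `2 * r` contains a ball of radius `r / 2` centred at distance
`3 / 2 * r` from `c`. By doubling this ball carries at least the fraction `D⁻¹` of the mass of the
ball of radius `2 * r`, so `σ = 1 + D⁻¹` works; then iterate. -/
theorem IsMultipleWeight.exists_reverse_doubling (hn : 0 < n) (hp : 0 < p) (hP : ∀ i, 1 ≤ P i)
    (hw : IsMultipleWeight P p w) :
    ∃ σ : ℝ≥0∞, 1 < σ ∧ ∀ (c : E n) (r : ℝ), 0 < r → ∀ k : ℕ,
      σ ^ k * wMeasure (nuWeight P p w) (Metric.ball c r) ≤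
        wMeasure (nuWeight P p w) (Metric.ball c (2 ^ k * r)) := by
  obtain ⟨D, hD, h⟩ := hw.exists_doubling hp hP
  have hstep : ∀ (c : E n) (r : ℝ), 0 < r →
      (1 + D⁻¹) * wMeasure (nuWeight P p w) (Metric.ball c r) ≤
        wMeasure (nuWeight P p w) (Metric.ball c (2 * r)) := by
    intro c r hr
    have : Nonempty (Fin n) := ⟨⟨0, hn⟩⟩
    obtain ⟨e, he⟩ := exists_norm_eq (E n) (show (0 : ℝ) ≤ 3 / 2 * r by positivity)
    set c' := c + e with hc'
    have hdist : dist c' c = 3 / 2 * r := by simp [hc', dist_eq_norm, he]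
    have hsub : Metric.ball c' (r / 2) ⊆ Metric.ball c (2 * r) :=
      Metric.ball_subset_ball' (by rw [hdist]; linarith)
    have hdisj : Disjoint (Metric.ball c r) (Metric.ball c' (r / 2)) :=
      Metric.ball_disjoint_ball (by rw [dist_comm, hdist]; linarith)
    have h1 := h c' c (r / 2) (by positivity)
      (by rw [show 4 * (r / 2) = 2 * r by ring]; exact hsub)
    rw [show 4 * (r / 2) = 2 * r by ring] at h1
    have hb : Metric.ball c r ⊆ Metric.ball c (2 * r) := Metric.ball_subset_ball (by linarith)
    rw [add_mul, one_mul]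
    calc _ ≤ wMeasure (nuWeight P p w) (Metric.ball c r) +
          wMeasure (nuWeight P p w) (Metric.ball c' (r / 2)) := by
          gcongr
          rw [mul_comm, ← ENNReal.div_eq_inv_mul.trans (mul_comm _ _)]
          exact ENNReal.div_le_of_le_mul' ((measure_mono hb).trans h1)
      _ = wMeasure (nuWeight P p w) (Metric.ball c r ∪ Metric.ball c' (r / 2)) :=
          (measure_union hdisj measurableSet_ball).symm
      _ ≤ _ := measure_mono (Set.union_subset hb hsub)
  refine ⟨1 + D⁻¹, ENNReal.lt_add_right ENNReal.one_ne_top (ENNReal.inv_ne_zero.2 hD),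
    fun c r hr k => ?_⟩
  induction k with
  | zero => simp
  | succ k ih =>
    calc _ = (1 + D⁻¹) * ((1 + D⁻¹) ^ k * wMeasure (nuWeight P p w) (Metric.ball c r)) := by
          rw [pow_succ]; ring
      _ ≤ (1 + D⁻¹) * wMeasure (nuWeight P p w) (Metric.ball c (2 ^ k * r)) := by gcongr
      _ ≤ _ := by
          refine (hstep c _ (by positivity)).trans_eq ?_
          rw [pow_succ]; congr 2; ring

end MultipleWeight

/-! ### Local estimates by Morrey norms. -/

section Morrey

theorem eLpNorm_restrict_wMeasure_ball {q : ℝ} (hq : 1 ≤ q) {w : E n → ℝ} (hw : IsWeight w)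
    {f : E n → ℂ} (hf : AEStronglyMeasurable f volume) (c : E n) (r : ℝ) :
    eLpNorm f (ENNReal.ofReal q) ((wMeasure w).restrict (Metric.ball c r)) =
      (∫⁻ x in Metric.ball c r, ENNReal.ofReal (w x) * ‖f x‖ₑ ^ q) ^ (1 / q) := by
  rw [eLpNorm_eq_lintegral_rpow_enorm_toReal (by simp; linarith) ENNReal.ofReal_ne_top,
    ENNReal.toReal_ofReal (by linarith), wMeasure, restrict_withDensity measurableSet_ball,
    lintegral_withDensity_eq_lintegral_mul₀ hw.aemeasurable.restrict
      (hf.enorm.pow_const _).restrict]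
  rfl

/-- Hölder's inequality on a ball, for the weighted norm and the dual average. -/
theorem setLIntegral_enorm_le_dualAverage_mul {q : ℝ} (hq : 1 ≤ q) {w : E n → ℝ}
    (hw : IsWeight w) {f : E n → ℂ} (hf : AEStronglyMeasurable f volume) (c : E n) {r : ℝ}
    (hr : 0 < r) :
    ∫⁻ x in Metric.ball c r, ‖f x‖ₑ ≤
      volume (Metric.ball c r) ^ (1 - 1 / q) * dualAverage q w (Metric.ball c r) *
        eLpNorm f (ENNReal.ofReal q) ((wMeasure w).restrict (Metric.ball c r)) := by
  rw [eLpNorm_restrict_wMeasure_ball hq hw hf, dualAverage]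
  have hq0 : 0 ≤ 1 - 1 / q := by rw [sub_nonneg, div_le_one₀ (by linarith)]; exact hq
  split_ifs with hq1
  · simp only [hq1, div_one, sub_self, ENNReal.rpow_zero, one_mul, ENNReal.rpow_one]
    rw [← lintegral_const_mul'' (f := fun x => ENNReal.ofReal (w x) * ‖f x‖ₑ) _
      (hw.aemeasurable.mul hf.enorm).restrict]
    refine lintegral_mono_ae ?_
    filter_upwards [ae_restrict_of_ae hw.ae_ne, ae_essInf_le
      (f := fun x => ENNReal.ofReal (w x)) (μ := volume.restrict (Metric.ball c r))] with x hx hi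
    calc ‖f x‖ₑ = (ENNReal.ofReal (w x))⁻¹ * (ENNReal.ofReal (w x) * ‖f x‖ₑ) := by
          rw [← mul_assoc, ENNReal.inv_mul_cancel hx.1 hx.2, one_mul]
      _ ≤ _ := by gcongr
  · have hq' : 0 < q - 1 := sub_pos.2 (lt_of_le_of_ne hq (Ne.symm hq1))
    have hv := volume_ball_pos_ne c hr
    rw [← ENNReal.mul_rpow_of_nonneg _ _ hq0, setLAverage_eq, ENNReal.mul_div_cancel hv.1 hv.2,
      mul_comm]
    -- Hölder for the splitting `‖f‖ = (w ‖f‖^q)^(1/q) * (w^(-1/(q-1)))^(1-1/q)`.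
    refine le_trans (lintegral_mono_ae ?_) (ENNReal.lintegral_mul_norm_pow_le
      (μ := volume.restrict (Metric.ball c r))
      (hw.aemeasurable.mul (hf.enorm.pow_const q)).restrict
      (hw.aemeasurable.pow_const (-1 / (q - 1))).restrict (by positivity) hq0 (by ring))
    filter_upwards [ae_restrict_of_ae hw.ae_ne] with x hx
    refine le_of_eq ?_
    have h1 : q * (1 / q) = 1 := by field_simp
    have h2 : 1 / q + -1 / (q - 1) * (1 - 1 / q) = 0 := by
      field_simp
      ring
    simp only [Pi.mul_apply]
    rw [ENNReal.mul_rpow_of_nonneg _ _ (by positivity), ← ENNReal.rpow_mul, ← ENNReal.rpow_mul,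
      mul_right_comm, ← ENNReal.rpow_add _ _ hx.1 hx.2, h1, h2]
    simp

theorem eLpNorm_restrict_ball_le_morreyNorm {q κ : ℝ} {w : E n → ℝ} (hw : IsWeight w)
    {Y : Type*} [NormedAddCommGroup Y] (f : E n → Y) (c : E n) {r : ℝ} (hr : 0 < r) :
    eLpNorm f (ENNReal.ofReal q) ((wMeasure w).restrict (Metric.ball c r)) ≤
      wMeasure w (Metric.ball c r) ^ (κ / q) * morreyNorm q κ w f := by
  have h0 := hw.wMeasure_ball_ne_zero c hr
  have h1 := hw.wMeasure_ball_ne_top c r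
  have : wMeasure w (Metric.ball c r) ^ (-κ / q) *
      eLpNorm f (ENNReal.ofReal q) ((wMeasure w).restrict (Metric.ball c r)) ≤
        morreyNorm q κ w f :=
    le_iSup_of_le c (le_iSup_of_le r (le_iSup_of_le hr le_rfl))
  calc _ = wMeasure w (Metric.ball c r) ^ (κ / q) * (wMeasure w (Metric.ball c r) ^ (-κ / q) *
      eLpNorm f (ENNReal.ofReal q) ((wMeasure w).restrict (Metric.ball c r))) := by
        rw [← mul_assoc, ← ENNReal.rpow_add _ _ h0 h1, neg_div, add_neg_cancel,
          ENNReal.rpow_zero, one_mul]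
    _ ≤ _ := by gcongr

variable {P : Fin m → ℝ} {p : ℝ} {w : Fin m → E n → ℝ}

/-- The product of the norms on a ball is controlled by the Morrey norms. -/
theorem exists_prod_eLpNorm_ball_le (hm : 0 < m) (hP : ∀ i, 1 ≤ P i)
    (hp : 1 / p = ∑ i, 1 / P i) (hw : ∀ i, IsWeight (w i)) (hw' : ∀ i, IsAInfty (w i))
    {κ : ℝ} (hκ : 0 < κ) :
    ∃ C : ℝ≥0∞, C ≠ ∞ ∧ ∀ (f : Fin m → E n → ℂ) (c : E n) (r : ℝ), 0 < r →
      ∏ i, eLpNorm (f i) (ENNReal.ofReal (P i)) ((wMeasure (w i)).restrict (Metric.ball c r)) ≤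
        C * wMeasure (nuWeight P p w) (Metric.ball c r) ^ (κ / p) *
          ∏ i, morreyNorm (P i) κ (w i) (f i) := by
  have hp0 := exponent_pos hm hP hp
  have hκp : 0 ≤ κ / p := by positivity
  obtain ⟨C, hC⟩ := exists_prod_wMeasure_ball_rpow_le hm hP hp hw hw'
  refine ⟨(C : ℝ≥0∞) ^ (κ / p), ENNReal.rpow_ne_top_of_nonneg hκp ENNReal.coe_ne_top,
    fun f c r hr => ?_⟩
  refine (Finset.prod_le_prod' fun i _ =>
    eLpNorm_restrict_ball_le_morreyNorm (κ := κ) (hw i) (f i) c hr).trans ?_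
  rw [Finset.prod_mul_distrib, ← ENNReal.mul_rpow_of_nonneg _ _ hκp]
  gcongr
  -- Since `κ / P i = (p / P i) * (κ / p)`, this is the comparison of `ν` with the factors raised to
  -- the power `κ / p`.
  refine le_trans (le_of_eq ?_) (ENNReal.rpow_le_rpow (hC c r hr) hκp)
  rw [← ENNReal.prod_rpow_of_nonneg hκp]
  refine Finset.prod_congr rfl fun i _ => ?_
  rw [← ENNReal.rpow_mul]
  congr 1
  field_simp

/-- Hölder produces `|B|^(m - 1/p)` and the dual averages, which `A_P` turns into `|B|^(1/p)
ν(B)^(-1/p)`; the norms contribute `ν(B)^(κ/p)`. The resulting exponent `(κ - 1) / p` is negative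
for `κ < 1`, which is what makes the tail summable. -/
theorem exists_prod_setLIntegral_enorm_le (hm : 0 < m) (hP : ∀ i, 1 ≤ P i)
    (hp : 1 / p = ∑ i, 1 / P i) (hw : IsMultipleWeight P p w) (hw' : ∀ i, IsAInfty (w i))
    {κ : ℝ} (hκ : 0 < κ) :
    ∃ C : ℝ≥0∞, C ≠ ∞ ∧ ∀ (f : Fin m → E n → ℂ), (∀ i, AEStronglyMeasurable (f i) volume) →
      ∀ (c : E n) (r : ℝ), 0 < r →
      ∏ i, ∫⁻ x in Metric.ball c r, ‖f i x‖ₑ ≤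
        C * volume (Metric.ball c r) ^ m *
          wMeasure (nuWeight P p w) (Metric.ball c r) ^ ((κ - 1) / p) *
          ∏ i, morreyNorm (P i) κ (w i) (f i) := by
  have hp0 := exponent_pos hm hP hp
  obtain ⟨C₁, hC₁, h₁⟩ := exists_prod_eLpNorm_ball_le hm hP hp hw.1 hw' hκ
  have hw₀ := hw
  obtain ⟨hw, C, hC⟩ := hw
  refine ⟨C * C₁, ENNReal.mul_ne_top ENNReal.coe_ne_top hC₁, fun f hf c r hr => ?_⟩
  have hv := volume_ball_pos_ne c hr
  have hN0 := wMeasure_nuWeight_ball_ne_zero hp0 hP hw c hr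
  have hN1 := hw₀.wMeasure_nuWeight_ball_ne_top hp0 hP c hr
  refine (Finset.prod_le_prod' fun i _ =>
    setLIntegral_enorm_le_dualAverage_mul (hP i) (hw i) (hf i) c hr).trans ?_
  rw [Finset.prod_mul_distrib, Finset.prod_mul_distrib, prod_rpow_eq_rpow_sum hv.1 hv.2]
  have hsum : ∑ i, (1 - 1 / P i) = m - 1 / p := by
    rw [Finset.sum_sub_distrib, ← hp]; simp
  rw [hsum]
  set N := wMeasure (nuWeight P p w) (Metric.ball c r) with hN
  set V := volume (Metric.ball c r)
  have hdual : ∏ i, dualAverage (P i) (w i) (Metric.ball c r) ≤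
      C * (N ^ (-1 / p) * V ^ (1 / p)) := by
    have hav : (⨍⁻ x in Metric.ball c r, ENNReal.ofReal (nuWeight P p w x) ∂volume) ^ (1 / p) =
        N ^ (1 / p) * V ^ (-1 / p) := by
      rw [setLAverage_eq, ← wMeasure_apply_ball, ENNReal.div_rpow_of_nonneg _ _ (by positivity),
        neg_div, ENNReal.rpow_neg, div_eq_mul_inv]
    have h := hC c r hr
    rw [hav] at h
    calc _ = (N ^ (1 / p) * V ^ (-1 / p) * ∏ i, dualAverage (P i) (w i) (Metric.ball c r)) *
          (N ^ (-1 / p) * V ^ (1 / p)) := by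
          rw [show ∀ a b d x y : ℝ≥0∞, a * b * d * (x * y) = (a * x) * (b * y) * d by
            intros; ring, ← ENNReal.rpow_add _ _ hN0 hN1, ← ENNReal.rpow_add _ _ hv.1 hv.2,
            neg_div, add_neg_cancel, neg_add_cancel, ENNReal.rpow_zero, ENNReal.rpow_zero,
            one_mul, one_mul]
      _ ≤ _ := by gcongr
  calc _ ≤ V ^ ((m : ℝ) - 1 / p) * (C * (N ^ (-1 / p) * V ^ (1 / p))) *
        (C₁ * N ^ (κ / p) * ∏ i, morreyNorm (P i) κ (w i) (f i)) := by
        gcongr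
        exact h₁ f c r hr
    _ = (C * C₁) * (V ^ ((m : ℝ) - 1 / p) * V ^ (1 / p)) * (N ^ (κ / p) * N ^ (-1 / p)) *
        ∏ i, morreyNorm (P i) κ (w i) (f i) := by ring
    _ = _ := by
        rw [← ENNReal.rpow_add _ _ hN0 hN1, ← ENNReal.rpow_add _ _ hv.1 hv.2, sub_add_cancel,
          ENNReal.rpow_natCast, ← add_div, ← sub_eq_add_neg]

end Morrey

theorem lintegral_fin_prod_eq_prod {α : Type*} [MeasureSpace α] [SigmaFinite (volume : Measure α)] :
    ∀ {m : ℕ} {f : Fin m → α → ℝ≥0∞}, (∀ i, AEMeasurable (f i) volume) →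
      ∫⁻ y : Fin m → α, ∏ i, f i (y i) = ∏ i, ∫⁻ x, f i x := by
  intro m
  induction m with
  | zero => intro f _; simp [volume_pi]
  | succ m ih =>
    intro f hf
    have hmp := (volume_preserving_piFinSuccAbove (fun _ : Fin (m + 1) => α) 0).symm
    rw [← hmp.lintegral_comp_emb (MeasurableEquiv.measurableEmbedding _)]
    simp_rw [Fin.prod_univ_succ]
    simp only [MeasurableEquiv.piFinSuccAbove_symm_apply, Fin.insertNthEquiv,
      Fin.insertNth_zero, Equiv.coe_fn_mk, Fin.cons_succ, Fin.zero_succAbove, Fin.cons_zero]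
    rw [← ih fun i => hf i.succ, Measure.volume_eq_prod]
    refine lintegral_prod_mul (μ := volume) (ν := volume) (f := f 0)
      (g := fun y : Fin m → α => ∏ i, f i.succ (y i)) (hf 0) ?_
    refine Finset.aemeasurable_fun_prod _ fun i _ => ?_
    exact (hf i.succ).comp_quasiMeasurePreserving (Measure.quasiMeasurePreserving_eval _ i)

theorem rpow_le_rpow_of_exponent_nonpos {a : ℝ} (ha : a ≤ 0) {x y : ℝ≥0∞} (h : x ≤ y) :
    y ^ a ≤ x ^ a := by
  obtain ⟨b, rfl⟩ : ∃ b, a = -b := ⟨-a, (neg_neg a).symm⟩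
  rw [ENNReal.rpow_neg, ENNReal.rpow_neg, ENNReal.inv_le_inv]
  exact ENNReal.rpow_le_rpow h (neg_nonpos.1 ha)

/-! ### The kernel integral away from a ball. -/

section Tail

variable {X : Type*} [NormedAddCommGroup X] [NormedSpace ℂ X]
  {Q : E n → (Fin m → E n) → (ℂ →L[ℂ] X)}

/-- Restriction of a tuple of functions to a set. -/
def truncate (S : Set (E n)) (f : Fin m → E n → ℂ) : Fin m → E n → ℂ :=
  fun i => S.indicator (f i)

theorem integrand_truncate_of_mem {S : Set (E n)} {f : Fin m → E n → ℂ} {x : E n}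
    {y : Fin m → E n} (hy : ∀ i, y i ∈ S) :
    integrand Q (truncate S f) x y = integrand Q f x y := by
  simp [integrand, truncate, hy]

theorem integrand_truncate_of_notMem {S : Set (E n)} {f : Fin m → E n → ℂ} {x : E n}
    {y : Fin m → E n} {j : Fin m} (hy : y j ∉ S) : integrand Q (truncate S f) x y = 0 := by
  rw [integrand, Finset.prod_eq_zero (Finset.mem_univ j) (by simp [truncate, hy]), map_zero]

theorem enorm_integrand_le (f : Fin m → E n → ℂ) (x : E n) (y : Fin m → E n) :
    ‖integrand Q f x y‖ₑ ≤ ‖Q x y‖ₑ * ∏ i, ‖f i (y i)‖ₑ := by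
  have : ∏ i, ‖f i (y i)‖ₑ = ‖∏ i, f i (y i)‖ₑ := by
    simp only [enorm_eq_nnnorm, ← ENNReal.ofNNReal_finsetProd, nnnorm_prod]
  rw [this]
  exact (Q x y).le_opENorm _

/-- Take the least `k` whose ball contains all coordinates: minimality yields a far coordinate, and
for `k = 0` the hypothesis does. -/
theorem exists_dyadic_scale {c : E n} {r : ℝ} (hr : 0 < r) {y : Fin m → E n}
    (hy : ∃ j, y j ∉ Metric.ball c (2 * r)) :
    ∃ k : ℕ, (∀ i, y i ∈ Metric.ball c (2 ^ (k + 2) * r)) ∧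
      ∃ j, 2 ^ (k + 1) * r ≤ dist (y j) c := by
  classical
  have hex : ∃ k : ℕ, ∀ i, y i ∈ Metric.ball c (2 ^ (k + 2) * r) := by
    obtain ⟨k, hk⟩ := pow_unbounded_of_one_lt ((∑ i, dist (y i) c) / r) one_lt_two
    refine ⟨k, fun i => ?_⟩
    rw [Metric.mem_ball]
    have h1 : dist (y i) c ≤ ∑ i, dist (y i) c :=
      Finset.single_le_sum (f := fun i => dist (y i) c) (fun _ _ => dist_nonneg) (Finset.mem_univ i)
    have h2 := (div_lt_iff₀ hr).1 hk
    have h3 : (2 : ℝ) ^ k * r ≤ 2 ^ (k + 2) * r := by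
      gcongr
      · norm_num
      · omega
    linarith
  refine ⟨Nat.find hex, Nat.find_spec hex, ?_⟩
  rcases h : Nat.find hex with _ | k
  · obtain ⟨j, hj⟩ := hy
    exact ⟨j, by simpa using hj⟩
  · have := Nat.find_min hex (m := k) (by omega)
    push Not at this
    obtain ⟨j, hj⟩ := this
    exact ⟨j, by simpa using hj⟩

/-- The difference vanishes when all coordinates lie in the doubled ball. Otherwise the term at the
dyadic scale of `y` alone dominates it: some `y j` is at distance at least `2^(k+1) r - r ≥ 2^k r`
from `x`. -/
theorem SizeCondition.exists_enorm_integrand_sub_le (hQ : SizeCondition Q) :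
    ∃ C : ℝ, 0 ≤ C ∧ ∀ (f : Fin m → E n → ℂ) (c : E n) (r : ℝ), 0 < r → ∀ x ∈ Metric.ball c r,
      ∀ y, ‖integrand Q f x y - integrand Q (truncate (Metric.ball c (2 * r)) f) x y‖ₑ ≤
        ∑' k : ℕ, ENNReal.ofReal (C / (2 ^ k * r) ^ (m * n)) *
          ∏ i, (Metric.ball c (2 ^ (k + 2) * r)).indicator (fun z => ‖f i z‖ₑ) (y i) := by
  obtain ⟨C, hC⟩ := hQ
  refine ⟨max C 0, le_max_right _ _, fun f c r hr x hx y => ?_⟩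
  by_cases hy : ∀ i, y i ∈ Metric.ball c (2 * r)
  · simp [integrand_truncate_of_mem hy]
  push Not at hy
  obtain ⟨k, hk, j, hj⟩ := exists_dyadic_scale hr hy
  obtain ⟨j', hj'⟩ := hy
  rw [integrand_truncate_of_notMem hj', sub_zero]
  refine le_trans ?_ (ENNReal.le_tsum k)
  refine (enorm_integrand_le f x y).trans ?_
  have h1 : (1 : ℝ) ≤ 2 ^ k := one_le_pow₀ one_le_two
  have hkr : 0 < 2 ^ k * r := by positivity
  have hdist : 2 ^ k * r ≤ ‖x - y j‖ := by
    rw [← dist_eq_norm]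
    have h2 := dist_triangle_left (y j) c x
    have h3 := Metric.mem_ball.1 hx
    have h4 : r ≤ 2 ^ k * r := le_mul_of_one_le_left hr.le h1
    rw [pow_succ] at hj
    nlinarith
  have hsum : 2 ^ k * r ≤ ∑ j, ‖x - y j‖ := hdist.trans
    (Finset.single_le_sum (f := fun j => ‖x - y j‖) (fun _ _ => norm_nonneg _) (Finset.mem_univ j))
  gcongr with i
  · rw [← ofReal_norm]
    refine ENNReal.ofReal_le_ofReal ((hC x y ⟨j, fun h => ?_⟩).trans ?_)
    · rw [h, sub_self, norm_zero] at hdist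
      linarith
    · gcongr
      exact le_max_left _ _
  · rw [Set.indicator_of_mem (hk i)]

variable {P : Fin m → ℝ} {p : ℝ} {w : Fin m → E n → ℝ}

/-- The size condition is critical: kernel bound and volume cancel, leaving a constant independent
of scale. The ratio of the radii `2^(k+2) r` and `2^k r` accounts for `4 ^ (m * n)`. -/
theorem ofReal_mul_volume_ball_pow {C r : ℝ} (hC : 0 ≤ C) (hr : 0 < r) (c : E n) (k m : ℕ) :
    ENNReal.ofReal (C / (2 ^ k * r) ^ (m * n)) * volume (Metric.ball c (2 ^ (k + 2) * r)) ^ m =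
      ENNReal.ofReal (C * 4 ^ (m * n)) * volume (Metric.ball (0 : E n) 1) ^ m := by
  have hkr : 0 < 2 ^ (k + 2) * r := by positivity
  have hvol := volume_ball_eq_mul c 0 1 hkr
  rw [mul_one] at hvol
  rw [hvol, mul_pow (ENNReal.ofReal _), ← mul_assoc, ← ENNReal.ofReal_pow (by positivity),
    ← ENNReal.ofReal_mul (by positivity)]
  congr 2
  have : (0 : ℝ) < (2 ^ k * r) ^ (m * n) := by positivity
  rw [← pow_mul, mul_comm n m, show (2 : ℝ) ^ (k + 2) * r = 4 * (2 ^ k * r) by ring,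
    mul_pow 4]
  field_simp

/-- The part of the integral away from a ball, for functions in the Morrey spaces. -/
theorem exists_lintegral_integrand_sub_le (hn : 0 < n) (hm : 0 < m) (hQ : SizeCondition Q)
    (hP : ∀ i, 1 ≤ P i) (hp : 1 / p = ∑ i, 1 / P i) (hw : IsMultipleWeight P p w)
    (hw' : ∀ i, IsAInfty (w i)) {κ : ℝ} (hκ₀ : 0 < κ) (hκ₁ : κ < 1) :
    ∃ C : ℝ≥0∞, C ≠ ∞ ∧ ∀ f : Fin m → E n → ℂ, (∀ i, AEStronglyMeasurable (f i) volume) →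
      ∀ (c : E n) (r : ℝ), 0 < r → ∀ x ∈ Metric.ball c r,
      ∫⁻ y, ‖integrand Q f x y - integrand Q (truncate (Metric.ball c (2 * r)) f) x y‖ₑ ≤
        C * wMeasure (nuWeight P p w) (Metric.ball c r) ^ ((κ - 1) / p) *
          ∏ i, morreyNorm (P i) κ (w i) (f i) := by
  have hp0 := exponent_pos hm hP hp
  obtain ⟨C₀, hC₀, h₀⟩ := hQ.exists_enorm_integrand_sub_le
  obtain ⟨C₁, hC₁, h₁⟩ := exists_prod_setLIntegral_enorm_le hm hP hp hw hw' hκ₀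
  obtain ⟨σ, hσ, h₂⟩ := hw.exists_reverse_doubling hn hp0 hP
  set V : ℝ≥0∞ := volume (Metric.ball (0 : E n) 1)
  have hV : V ≠ ∞ := (volume_ball_pos_ne 0 one_pos).2
  have hneg : (κ - 1) / p < 0 := div_neg_of_neg_of_pos (by linarith) hp0
  set τ : ℝ≥0∞ := σ ^ ((κ - 1) / p)
  have hτ : τ < 1 := ENNReal.rpow_lt_one_of_one_lt_of_neg hσ hneg
  refine ⟨ENNReal.ofReal (C₀ * 4 ^ (m * n)) * V ^ m * C₁ * (1 - τ)⁻¹, ?_,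
    fun f hf c r hr x hx => ?_⟩
  · refine ENNReal.mul_ne_top (ENNReal.mul_ne_top (ENNReal.mul_ne_top ENNReal.ofReal_ne_top
      (ENNReal.pow_ne_top hV)) hC₁) (ENNReal.inv_ne_top.2 (tsub_pos_of_lt hτ).ne')
  set N := wMeasure (nuWeight P p w) (Metric.ball c r)
  have hN0 : N ≠ 0 := wMeasure_nuWeight_ball_ne_zero hp0 hP hw.1 c hr
  set M := ∏ i, morreyNorm (P i) κ (w i) (f i)
  have hpt := h₀ f c r hr x hx
  have hmeas : ∀ (k : ℕ) i, AEMeasurable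
      ((Metric.ball c (2 ^ (k + 2) * r)).indicator (fun z => ‖f i z‖ₑ)) volume := fun k i =>
    (hf i).enorm.indicator measurableSet_ball
  have hmeas' : ∀ k : ℕ, AEMeasurable (fun y : Fin m → E n =>
      ∏ i, (Metric.ball c (2 ^ (k + 2) * r)).indicator (fun z => ‖f i z‖ₑ) (y i)) volume := fun k =>
    Finset.aemeasurable_fun_prod _ fun i _ =>
      (hmeas k i).comp_quasiMeasurePreserving (Measure.quasiMeasurePreserving_eval _ i)
  calc _ ≤ ∫⁻ y : Fin m → E n, ∑' k : ℕ, ENNReal.ofReal (C₀ / (2 ^ k * r) ^ (m * n)) *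
          ∏ i, (Metric.ball c (2 ^ (k + 2) * r)).indicator (fun z => ‖f i z‖ₑ) (y i) :=
        lintegral_mono hpt
    _ = ∑' k : ℕ, ENNReal.ofReal (C₀ / (2 ^ k * r) ^ (m * n)) *
          ∏ i, ∫⁻ z in Metric.ball c (2 ^ (k + 2) * r), ‖f i z‖ₑ := by
        rw [lintegral_tsum fun k => (hmeas' k).const_mul _]
        congr 1 with k
        rw [lintegral_const_mul'' _ (hmeas' k), lintegral_fin_prod_eq_prod (hmeas k)]
        simp_rw [lintegral_indicator measurableSet_ball]
    _ ≤ ∑' k : ℕ, (ENNReal.ofReal (C₀ * 4 ^ (m * n)) * V ^ m * C₁ * N ^ ((κ - 1) / p) * M) *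
          τ ^ k := by
        refine ENNReal.tsum_le_tsum fun k => ?_
        have hkr : 0 < 2 ^ (k + 2) * r := by positivity
        have hconst := ofReal_mul_volume_ball_pow hC₀ hr c k m
        have hdecay : wMeasure (nuWeight P p w) (Metric.ball c (2 ^ (k + 2) * r)) ^ ((κ - 1) / p) ≤
            τ ^ k * N ^ ((κ - 1) / p) := by
          refine (rpow_le_rpow_of_exponent_nonpos hneg.le (h₂ c r hr (k + 2))).trans ?_
          rw [ENNReal.mul_rpow_of_ne_zero (pow_ne_zero _ (zero_lt_one.trans hσ).ne') hN0]
          gcongr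
          rw [← ENNReal.rpow_natCast, ← ENNReal.rpow_mul, mul_comm, ENNReal.rpow_mul,
            ENNReal.rpow_natCast]
          -- Reverse doubling gives `τ ^ (k + 2)`; the two extra factors are dropped.
          exact pow_le_pow_right_of_le_one' hτ.le (by omega)
        calc _ ≤ ENNReal.ofReal (C₀ / (2 ^ k * r) ^ (m * n)) *
              (C₁ * volume (Metric.ball c (2 ^ (k + 2) * r)) ^ m *
                (τ ^ k * N ^ ((κ - 1) / p)) * M) := by
              gcongr
              refine (h₁ f hf c _ hkr).trans ?_
              gcongr
          _ = (ENNReal.ofReal (C₀ / (2 ^ k * r) ^ (m * n)) *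
              volume (Metric.ball c (2 ^ (k + 2) * r)) ^ m) * C₁ * N ^ ((κ - 1) / p) * M *
                τ ^ k := by ring
          _ = _ := by rw [hconst]
    _ = _ := by
        rw [ENNReal.tsum_mul_left, ENNReal.tsum_geometric]
        ring

end Tail

/-! ### Stability of the function classes under truncation. -/

section Classes

theorem indicator_mem_lebesgueClass {q : ℝ} {w : E n → ℝ} {f : E n → ℂ}
    (hf : f ∈ lebesgueClass q w) {S : Set (E n)} (hS : MeasurableSet S) :
    S.indicator f ∈ lebesgueClass q w :=
  MemLp.indicator hS hf

theorem indicator_mem_morreyClass {q κ : ℝ} {w : E n → ℝ} {f : E n → ℂ}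
    (hf : f ∈ morreyClass q κ w) {S : Set (E n)} (hS : MeasurableSet S) :
    S.indicator f ∈ morreyClass q κ w := by
  refine ⟨hf.1.indicator hS, lt_of_le_of_lt ?_ hf.2⟩
  refine iSup_mono fun c => iSup_mono fun r => iSup_mono fun _ => ?_
  gcongr
  exact eLpNorm_indicator_le _

theorem indicator_mem_lebesgueClass_of_mem_morreyClass {q κ : ℝ} (hq : 1 ≤ q) (hκ : 0 < κ)
    {w : E n → ℝ} (hw : IsWeight w) {f : E n → ℂ} (hf : f ∈ morreyClass q κ w) {S : Set (E n)}
    (hS : MeasurableSet S) {c : E n} {r : ℝ} (hr : 0 < r) (hSB : S ⊆ Metric.ball c r) :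
    S.indicator f ∈ lebesgueClass q w := by
  have h : (Metric.ball c r).indicator f ∈ lebesgueClass q w := by
    refine (memLp_indicator_iff_restrict measurableSet_ball).2 ⟨?_, ?_⟩
    · exact (hf.1.mono_ac (wMeasure_absolutelyContinuous w)).restrict
    · refine lt_of_le_of_lt (eLpNorm_restrict_ball_le_morreyNorm (κ := κ) hw f c hr) ?_
      exact ENNReal.mul_lt_top (ENNReal.rpow_lt_top_of_nonneg (by positivity)
        (hw.wMeasure_ball_ne_top c r)) hf.2
  have h2 := indicator_mem_lebesgueClass h hS
  rwa [Set.indicator_indicator, Set.inter_eq_left.2 hSB] at h2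

end Classes

variable {X : Type*} [NormedAddCommGroup X] [NormedSpace ℂ X]
  {Q : E n → (Fin m → E n) → (ℂ →L[ℂ] X)}

/-! ### Multilinearity and measurability of the integrand. -/

section Integrand

theorem prod_update_apply (f : Fin m → E n → ℂ) (i : Fin m) (g : E n → ℂ) (y : Fin m → E n) :
    ∏ j, Function.update f i g j (y j) = g (y i) * ∏ j ∈ Finset.univ.erase i, f j (y j) := by
  rw [← Finset.mul_prod_erase _ _ (Finset.mem_univ i), Function.update_self]
  congr 1
  exact Finset.prod_congr rfl fun j hj => by rw [Function.update_of_ne (Finset.ne_of_mem_erase hj)]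

theorem integrand_update_add (f : Fin m → E n → ℂ) (i : Fin m) (g h : E n → ℂ) (x : E n)
    (y : Fin m → E n) :
    integrand Q (Function.update f i (g + h)) x y =
      integrand Q (Function.update f i g) x y + integrand Q (Function.update f i h) x y := by
  simp only [integrand, prod_update_apply, Pi.add_apply, add_mul, map_add]

theorem integrand_update_smul (f : Fin m → E n → ℂ) (i : Fin m) (a : ℂ) (g : E n → ℂ) (x : E n)
    (y : Fin m → E n) :
    integrand Q (Function.update f i (a • g)) x y =
      a • integrand Q (Function.update f i g) x y := by
  simp only [integrand, prod_update_apply, Pi.smul_apply, smul_eq_mul, mul_assoc]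
  rw [← smul_eq_mul, map_smul]

theorem truncate_update (S : Set (E n)) (f : Fin m → E n → ℂ) (i : Fin m) (g : E n → ℂ) :
    truncate S (Function.update f i g) = Function.update (truncate S f) i (S.indicator g) := by
  ext j x
  rcases eq_or_ne j i with rfl | h
  · simp [truncate]
  · simp [truncate, h]

theorem truncate_univ (f : Fin m → E n → ℂ) : truncate Set.univ f = f := by
  ext j x
  simp [truncate]

theorem aestronglyMeasurable_integrand
    (hQ : AEStronglyMeasurable (fun z : E n × (Fin m → E n) => Q z.1 z.2) volume)
    {f : Fin m → E n → ℂ} (hf : ∀ i, AEStronglyMeasurable (f i) volume) :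
    AEStronglyMeasurable (fun z : E n × (Fin m → E n) => integrand Q f z.1 z.2)
      (volume.prod volume) := by
  have h1 : AEStronglyMeasurable (fun z : E n × (Fin m → E n) => ∏ j, f j (z.2 j))
      (volume.prod volume) := by
    refine Finset.aestronglyMeasurable_fun_prod _ fun j _ => ?_
    exact ((hf j).comp_quasiMeasurePreserving (Measure.quasiMeasurePreserving_eval
      (fun _ : Fin m => (volume : Measure (E n))) j)).comp_quasiMeasurePreserving
        (Measure.quasiMeasurePreserving_snd (μ := (volume : Measure (E n))))
  exact isBoundedBilinearMap_apply.continuous.comp_aestronglyMeasurable (hQ.prodMk h1)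

end Integrand

/-! ### Truncation identities and the extended operator. -/

section Expansion

variable {D : Fin m → Set (E n → ℂ)} {T : (Fin m → E n → ℂ) → E n → X}

/-- Outside the closure of `Sᶜ`, changing the truncation from `S` to a larger set changes `T f` by
an absolutely convergent integral. -/
theorem IsKernelOperator.ae_truncate_eq (hT : IsKernelOperator Q D T) {f : Fin m → E n → ℂ}
    {S S' : Set (E n)} (hSS' : S ⊆ S') (hS : ∀ i, S.indicator (f i) ∈ D i)
    (hS' : ∀ i, S'.indicator (f i) ∈ D i) (hd : ∀ i, (S' \ S).indicator (f i) ∈ D i) :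
    ∀ᵐ x, x ∉ closure Sᶜ →
      Integrable (fun y => integrand Q (truncate S' f) x y - integrand Q (truncate S f) x y) ∧
      T (truncate S' f) x = T (truncate S f) x +
        ∫ y, (integrand Q (truncate S' f) x y - integrand Q (truncate S f) x y) := by
  classical
  -- Change the entries one at a time. Each change adds a tuple with one entry supported off `S`, to
  -- which the integral formula applies outside `closure Sᶜ`.
  have key : ∀ s : Finset (Fin m), ∀ᵐ x, x ∉ closure Sᶜ →
      Integrable (fun y => integrand Q (s.piecewise (truncate S' f) (truncate S f)) x y -
        integrand Q (truncate S f) x y) ∧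
      T (s.piecewise (truncate S' f) (truncate S f)) x = T (truncate S f) x +
        ∫ y, (integrand Q (s.piecewise (truncate S' f) (truncate S f)) x y -
          integrand Q (truncate S f) x y) := by
    intro s
    induction s using Finset.induction_on with
    | empty => simp
    | insert j s hj ih =>
      set g := s.piecewise (truncate S' f) (truncate S f) with hg
      have hgD : ∀ i, g i ∈ D i := fun i => by
        by_cases hi : i ∈ s
        · rw [hg, Finset.piecewise_eq_of_mem _ _ _ hi]; exact hS' i
        · rw [hg, Finset.piecewise_eq_of_notMem _ _ _ hi]; exact hS i
      have hgj : Function.update g j (S.indicator (f j)) = g := by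
        rw [Function.update_eq_self_iff, hg, Finset.piecewise_eq_of_notMem _ _ _ hj]; rfl
      have hsplit : S'.indicator (f j) = S.indicator (f j) + (S' \ S).indicator (f j) := by
        
        rw [← Set.union_sdiff_cancel hSS', Set.indicator_union_of_disjoint
          Set.disjoint_sdiff_right, Set.union_sdiff_cancel hSS']
        rfl
      have hins : (insert j s).piecewise (truncate S' f) (truncate S f) =
          Function.update g j (S.indicator (f j) + (S' \ S).indicator (f j)) := by
        rw [Finset.piecewise_insert, ← hsplit]; rfl
      have hdD : ∀ i, Function.update g j ((S' \ S).indicator (f j)) i ∈ D i := fun i => by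
        rcases eq_or_ne i j with rfl | hi
        · rw [Function.update_self]; exact hd i
        · rw [Function.update_of_ne hi]; exact hgD i
      filter_upwards [ih, hT.map_add g hgD j _ (hS j) _ (hd j), hT.integral_formula _ hdD]
        with x hx hadd hint hxS
      obtain ⟨hx1, hx2⟩ := hx hxS
      obtain ⟨hi1, hi2⟩ := hint fun hmem => hxS <| by
        have := Set.mem_iInter.1 hmem j
        rw [Function.update_self] at this
        refine closure_mono (fun z hz => ?_) this
        exact (Set.indicator_apply_ne_zero.1 hz).1.2
      have hI : (fun y => integrand Q ((insert j s).piecewise (truncate S' f) (truncate S f)) x y -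
          integrand Q (truncate S f) x y) = fun y => (integrand Q g x y -
            integrand Q (truncate S f) x y) +
            integrand Q (Function.update g j ((S' \ S).indicator (f j))) x y := by
        ext y
        rw [hins, integrand_update_add, hgj]
        abel
      rw [hI]
      refine ⟨hx1.add hi1, ?_⟩
      rw [integral_add hx1 hi1, hins, hadd, hgj, hx2, hi2, add_assoc]
  simpa using key Finset.univ

/-- The value that the truncation `S` assigns to an extension of `T`. -/
def localExtension (Q : E n → (Fin m → E n) → (ℂ →L[ℂ] X)) (T : (Fin m → E n → ℂ) → E n → X)
    (S : Set (E n)) (f : Fin m → E n → ℂ) (x : E n) : X :=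
  T (truncate S f) x + ∫ y, (integrand Q f x y - integrand Q (truncate S f) x y)

/-- Enlarging the truncation to the whole space shows that an operator defined at `f` is already
recovered from its truncations. Applied to `T` this gives agreement on the common domain, and
applied to any other extension it gives uniqueness. -/
theorem IsKernelOperator.ae_eq_localExtension (hT : IsKernelOperator Q D T)
    {f : Fin m → E n → ℂ} {S : Set (E n)} (hf : ∀ i, f i ∈ D i)
    (hS : ∀ i, S.indicator (f i) ∈ D i) (hSc : ∀ i, Sᶜ.indicator (f i) ∈ D i) :
    ∀ᵐ x, x ∉ closure Sᶜ → T f x = localExtension Q T S f x := by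
  filter_upwards [hT.ae_truncate_eq (Set.subset_univ S) hS (by simpa using hf)
    (by simpa [← Set.compl_eq_univ_sdiff] using hSc)] with x hx hxS
  have h := (hx hxS).2
  rw [truncate_univ] at h
  exact h

theorem ball_notMem_closure_compl {c x : E n} {r : ℝ} (hr : 0 < r) (hx : x ∈ Metric.ball c r) :
    x ∉ closure (Metric.ball c (2 * r))ᶜ := by
  rw [Metric.isOpen_ball.isClosed_compl.closure_eq, Set.notMem_compl_iff]
  exact Metric.ball_subset_ball (by linarith) hx

theorem mem_ball_floor_norm_add_one (x : E n) : x ∈ Metric.ball (0 : E n) (⌊‖x‖⌋₊ + 1) := by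
  rw [mem_ball_zero_iff]
  exact Nat.lt_floor_add_one _

/-- The extension of `T`, defined by truncation to a ball that depends on the point. -/
def extension (Q : E n → (Fin m → E n) → (ℂ →L[ℂ] X)) (T : (Fin m → E n → ℂ) → E n → X)
    (f : Fin m → E n → ℂ) (x : E n) : X :=
  localExtension Q T (Metric.ball 0 (2 * (⌊‖x‖⌋₊ + 1))) f x

theorem aestronglyMeasurable_integral_sub_truncate
    (hQ : AEStronglyMeasurable (fun z : E n × (Fin m → E n) => Q z.1 z.2) volume)
    {f : Fin m → E n → ℂ} (hf : ∀ i, AEStronglyMeasurable (f i) volume) {S : Set (E n)}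
    (hS : MeasurableSet S) :
    AEStronglyMeasurable
      (fun x => ∫ y, (integrand Q f x y - integrand Q (truncate S f) x y)) volume :=
  AEStronglyMeasurable.integral_prod_right' ((aestronglyMeasurable_integrand hQ hf).sub
    (aestronglyMeasurable_integrand hQ fun i => (hf i).indicator hS))

variable {D' : Fin m → Set (E n → ℂ)}

/-- Operators with kernel `Q` extend from `D` to `D'` by truncation: both classes are stable under
restriction to sets, restrictions of functions in `D'` to bounded sets belong to `D`, and the integrals
over the remaining region converge absolutely. -/
structure ExtendsByTruncation (Q : E n → (Fin m → E n) → (ℂ →L[ℂ] X))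
    (D D' : Fin m → Set (E n → ℂ)) : Prop where
  aestronglyMeasurable : ∀ i, ∀ f ∈ D' i, AEStronglyMeasurable f volume
  indicator_mem : ∀ i, ∀ f ∈ D' i, ∀ S, MeasurableSet S → S.indicator f ∈ D' i
  indicator_mem_of_mem : ∀ i, ∀ f ∈ D i, ∀ S, MeasurableSet S → S.indicator f ∈ D i
  indicator_mem_of_subset : ∀ i, ∀ f ∈ D' i, ∀ S, MeasurableSet S → ∀ c r, 0 < r →
    S ⊆ Metric.ball c r → S.indicator f ∈ D i
  integrable : ∀ f, (∀ i, f i ∈ D' i) → ∀ c r, 0 < r → ∀ᵐ x, x ∈ Metric.ball c r →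
    Integrable fun y => integrand Q f x y - integrand Q (truncate (Metric.ball c (2 * r)) f) x y

namespace ExtendsByTruncation

theorem indicator_ball_mem (h : ExtendsByTruncation Q D D') {i : Fin m} {g : E n → ℂ}
    (hg : g ∈ D' i) (c : E n) {r : ℝ} (hr : 0 < r) : (Metric.ball c r).indicator g ∈ D i :=
  h.indicator_mem_of_subset i g hg _ measurableSet_ball c r hr subset_rfl

theorem truncate_ball_mem (h : ExtendsByTruncation Q D D') {f : Fin m → E n → ℂ}
    (hf : ∀ i, f i ∈ D' i) (c : E n) {r : ℝ} (hr : 0 < r) (i : Fin m) :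
    truncate (Metric.ball c r) f i ∈ D i :=
  h.indicator_ball_mem (hf i) c hr

/-- What `T` gains by enlarging the truncation is exactly what the tail integral loses. -/
theorem localExtension_ae_eq_of_subset (h : ExtendsByTruncation Q D D')
    (hT : IsKernelOperator Q D T)
    {f : Fin m → E n → ℂ} (hf : ∀ i, f i ∈ D' i) {c c' : E n} {r r' : ℝ} (hr : 0 < r)
    (hr' : 0 < r') (hsub : Metric.ball c (2 * r) ⊆ Metric.ball c' (2 * r')) :
    ∀ᵐ x, x ∈ Metric.ball c r → x ∈ Metric.ball c' r' →
      localExtension Q T (Metric.ball c' (2 * r')) f x =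
        localExtension Q T (Metric.ball c (2 * r)) f x := by
  have h2r : 0 < 2 * r := by positivity
  have h2r' : 0 < 2 * r' := by positivity
  filter_upwards [hT.ae_truncate_eq hsub (h.truncate_ball_mem hf c h2r)
    (h.truncate_ball_mem hf c' h2r') (fun i => h.indicator_mem_of_subset i _ (hf i) _
      (measurableSet_ball.diff measurableSet_ball) c' _ h2r' Set.sdiff_subset),
    h.integrable f hf c' r' hr'] with x h1 h2 hx hx'
  obtain ⟨hi, he⟩ := h1 (ball_notMem_closure_compl hr hx)
  rw [localExtension, localExtension, he, add_assoc, ← integral_add hi (h2 hx')]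
  simp

/-- Both sides are compared with one large ball about the origin. The balls in `extension` have
integer parameters, so the exceptional null sets are countable in number. -/
theorem extension_ae_eq_localExtension (h : ExtendsByTruncation Q D D')
    (hT : IsKernelOperator Q D T)
    {f : Fin m → E n → ℂ} (hf : ∀ i, f i ∈ D' i) (c : E n) {r : ℝ} (hr : 0 < r) :
    ∀ᵐ x, x ∈ Metric.ball c r →
      extension Q T f x = localExtension Q T (Metric.ball c (2 * r)) f x := by
  -- `K` is large enough for the big ball to contain `Metric.ball c (2 * r)` and for `⌊‖x‖⌋₊ ≤ K` on
  -- `Metric.ball c r`.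
  obtain ⟨K, hK⟩ := exists_nat_ge (‖c‖ + 2 * r)
  have hK1 : (0 : ℝ) < K + 1 := by positivity
  have hk : ∀ k : ℕ, k ≤ K → ∀ᵐ x, x ∈ Metric.ball (0 : E n) (k + 1) →
      x ∈ Metric.ball (0 : E n) (K + 1) →
      localExtension Q T (Metric.ball 0 (2 * (K + 1))) f x =
        localExtension Q T (Metric.ball 0 (2 * (k + 1))) f x := fun k hkK =>
    h.localExtension_ae_eq_of_subset hT hf (by positivity) hK1
      (Metric.ball_subset_ball (by gcongr))
  have hsub : Metric.ball c (2 * r) ⊆ Metric.ball 0 (2 * (K + 1)) :=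
    Metric.ball_subset_ball' (by rw [dist_zero_right]; linarith [norm_nonneg c])
  filter_upwards [ae_all_iff.2 fun k => ae_all_iff.2 (hk k),
    h.localExtension_ae_eq_of_subset hT hf hr hK1 hsub] with x h1 h2 hx
  have hxK : ‖x‖ < K := by
    have := norm_le_norm_add_norm_sub' x c
    rw [mem_ball_iff_norm] at hx
    linarith
  have hxb : x ∈ Metric.ball (0 : E n) (K + 1) := by
    rw [mem_ball_zero_iff]; linarith
  rw [← h2 hx hxb, h1 ⌊‖x‖⌋₊ (Nat.floor_le_of_le hxK.le) (mem_ball_floor_norm_add_one x) hxb]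
  rfl

theorem ae_integrable (h : ExtendsByTruncation Q D D') {f : Fin m → E n → ℂ}
    (hf : ∀ i, f i ∈ D' i) :
    ∀ᵐ x, Integrable fun y => integrand Q f x y -
      integrand Q (truncate (Metric.ball 0 (2 * (⌊‖x‖⌋₊ + 1))) f) x y := by
  filter_upwards [ae_all_iff.2 fun k : ℕ => h.integrable f hf 0 (k + 1) (by positivity)] with x hx
  exact hx _ (mem_ball_floor_norm_add_one x)

theorem update_mem {f : Fin m → E n → ℂ} (hf : ∀ i, f i ∈ D' i) (i : Fin m) {g : E n → ℂ}
    (hg : g ∈ D' i) (j : Fin m) :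
    Function.update f i g j ∈ D' j := by
  rcases eq_or_ne j i with rfl | hj
  · rwa [Function.update_self]
  · rw [Function.update_of_ne hj]; exact hf j

theorem isIntegralValue_extension {f : Fin m → E n → ℂ} {x : E n}
    (hx : Integrable fun y => integrand Q f x y -
      integrand Q (truncate (Metric.ball 0 (2 * (⌊‖x‖⌋₊ + 1))) f) x y)
    (hv : IsIntegralValue Q (truncate (Metric.ball 0 (2 * (⌊‖x‖⌋₊ + 1))) f) x
      (T (truncate (Metric.ball 0 (2 * (⌊‖x‖⌋₊ + 1))) f) x)) :
    IsIntegralValue Q f x (extension Q T f x) := by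
  constructor
  · refine (hx.add hv.1).congr (Filter.Eventually.of_forall fun y => ?_)
    simp
  · rw [extension, localExtension, hv.2, ← integral_add hv.1 hx]
    simp

/-- The truncating ball depends on the point but not on the functions, so linearity and the integral
formula are inherited almost everywhere from countably many truncations. Measurability is checked on
each ball of a countable cover, where a single truncation suffices. -/
theorem isKernelOperator_extension (h : ExtendsByTruncation Q D D') (hT : IsKernelOperator Q D T)
    (hQ : AEStronglyMeasurable (fun z : E n × (Fin m → E n) => Q z.1 z.2) volume) :
    IsKernelOperator Q D' (extension Q T) where
  aestronglyMeasurable f hf := by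
    have hU : (⋃ k : ℕ, Metric.ball (0 : E n) (k + 1)) = Set.univ :=
      Set.eq_univ_of_forall fun x => Set.mem_iUnion.2 ⟨⌊‖x‖⌋₊, mem_ball_floor_norm_add_one x⟩
    rw [← Measure.restrict_univ (μ := volume), ← hU, aestronglyMeasurable_iUnion_iff]
    intro k
    have hk : (0 : ℝ) < k + 1 := by positivity
    refine AEStronglyMeasurable.congr
      (f := localExtension Q T (Metric.ball 0 (2 * (k + 1))) f) ?_ ?_
    · exact ((hT.aestronglyMeasurable _ (h.truncate_ball_mem hf 0 (by positivity))).add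
        (aestronglyMeasurable_integral_sub_truncate hQ
          (fun i => h.aestronglyMeasurable i _ (hf i)) measurableSet_ball)).restrict
    · refine (ae_restrict_iff' measurableSet_ball).2 ?_
      filter_upwards [h.extension_ae_eq_localExtension hT hf 0 hk] with x hx hxb
      exact (hx hxb).symm
  map_add f hf i g hg g' hg' := by
    have hadd : ∀ k : ℕ, ∀ᵐ x, _ := fun k =>
      hT.map_add _ (h.truncate_ball_mem hf 0 (r := 2 * (k + 1)) (by positivity)) i _
        (h.indicator_ball_mem hg 0 (r := 2 * (k + 1)) (by positivity)) _
        (h.indicator_ball_mem hg' 0 (r := 2 * (k + 1)) (by positivity))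
    filter_upwards [ae_all_iff.2 hadd, h.ae_integrable (update_mem hf i hg),
      h.ae_integrable (update_mem hf i hg')] with x hx hg1 hg2
    have hx := hx ⌊‖x‖⌋₊
    simp only [extension, localExtension]
    simp only [truncate_update, Set.indicator_add'] at hg1 hg2 ⊢
    rw [hx, add_add_add_comm, ← integral_add hg1 hg2]
    congr 2 with y
    rw [integrand_update_add, integrand_update_add, add_sub_add_comm]
  map_smul f hf i g hg a := by
    have hsmul : ∀ k : ℕ, ∀ᵐ x, _ := fun k =>
      hT.map_smul _ (h.truncate_ball_mem hf 0 (r := 2 * (k + 1)) (by positivity)) i _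
        (h.indicator_ball_mem hg 0 (r := 2 * (k + 1)) (by positivity)) a
    filter_upwards [ae_all_iff.2 hsmul] with x hx
    have hx := hx ⌊‖x‖⌋₊
    simp only [extension, localExtension]
    have hind : ∀ S : Set (E n), S.indicator (a • g) = a • S.indicator g := fun S =>
      Set.indicator_const_smul S a g
    simp only [truncate_update, hind]
    rw [hx, smul_add, ← integral_smul]
    congr 2 with y
    rw [integrand_update_smul, integrand_update_smul, smul_sub]
  integral_formula f hf := by
    have hform : ∀ k : ℕ, ∀ᵐ x, _ := fun k =>
      hT.integral_formula _ (h.truncate_ball_mem hf 0 (r := 2 * (k + 1)) (by positivity))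
    filter_upwards [ae_all_iff.2 hform, h.ae_integrable hf] with x hx hi hxs
    refine isIntegralValue_extension hi (hx ⌊‖x‖⌋₊ fun hmem => hxs ?_)
    refine Set.mem_iInter.2 fun i => closure_mono (fun z hz => ?_) (Set.mem_iInter.1 hmem i)
    exact (Set.indicator_apply_ne_zero.1 hz).2

theorem isIntegralOperator_extension (h : ExtendsByTruncation Q D D')
    (hT : IsIntegralOperator Q D T) :
    IsIntegralOperator Q D' (extension Q T) := by
  intro f hf
  have hform : ∀ k : ℕ, ∀ᵐ x, _ := fun k =>
    hT _ (h.truncate_ball_mem hf 0 (r := 2 * (k + 1)) (by positivity))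
  filter_upwards [ae_all_iff.2 hform, h.ae_integrable hf] with x hx hi
  exact isIntegralValue_extension hi (hx ⌊‖x‖⌋₊)

theorem isKernelExtension_extension (h : ExtendsByTruncation Q D D') (hT : IsKernelOperator Q D T)
    (hQ : AEStronglyMeasurable (fun z : E n × (Fin m → E n) => Q z.1 z.2) volume) :
    IsKernelExtension Q D D' T (extension Q T) := by
  refine ⟨h.isKernelOperator_extension hT hQ, fun f hf _ => ?_⟩
  have hloc : ∀ k : ℕ, ∀ᵐ x, _ := fun k => hT.ae_eq_localExtension hf
    (fun i => h.indicator_mem_of_mem i _ (hf i) (Metric.ball 0 (2 * (k + 1))) measurableSet_ball)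
    (fun i => h.indicator_mem_of_mem i _ (hf i) _ measurableSet_ball.compl)
  filter_upwards [ae_all_iff.2 hloc] with x hx
  exact (hx ⌊‖x‖⌋₊ (ball_notMem_closure_compl (by positivity)
    (mem_ball_floor_norm_add_one x))).symm

/-- `T''` is determined by its values on truncations to balls, which lie in both domains and so
agree with `T`, and by tails that involve only the kernel. -/
theorem ae_eq_extension (h : ExtendsByTruncation Q D D') {T'' : (Fin m → E n → ℂ) → E n → X}
    (hT'' : IsKernelExtension Q D D' T T'') {f : Fin m → E n → ℂ} (hf : ∀ i, f i ∈ D' i) :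
    T'' f =ᵐ[volume] extension Q T f := by
  have hloc : ∀ k : ℕ, ∀ᵐ x, _ := fun k => hT''.1.ae_eq_localExtension hf
    (fun i => h.indicator_mem i _ (hf i) (Metric.ball 0 (2 * (k + 1))) measurableSet_ball)
    (fun i => h.indicator_mem i _ (hf i) _ measurableSet_ball.compl)
  have heq : ∀ k : ℕ, ∀ᵐ x, T'' (truncate (Metric.ball 0 (2 * (k + 1))) f) x =
      T (truncate (Metric.ball 0 (2 * (k + 1))) f) x := fun k =>
    hT''.2 _ (h.truncate_ball_mem hf 0 (by positivity))
      (fun i => h.indicator_mem i _ (hf i) _ measurableSet_ball)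
  filter_upwards [ae_all_iff.2 hloc, ae_all_iff.2 heq] with x hx hx'
  rw [hx ⌊‖x‖⌋₊ (ball_notMem_closure_compl (by positivity) (mem_ball_floor_norm_add_one x)),
    extension, localExtension, localExtension, hx']

end ExtendsByTruncation

end Expansion

/-! ### Morrey bounds for the extension. -/

section Main

variable {P : Fin m → ℝ} {p κ : ℝ} {w : Fin m → E n → ℝ}
  {T : (Fin m → E n → ℂ) → E n → X}

theorem extendsByTruncation_morreyClass (hn : 0 < n) (hm : 0 < m)
    (hQmeas : AEStronglyMeasurable (fun z : E n × (Fin m → E n) => Q z.1 z.2) volume)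
    (hQ : SizeCondition Q) (hP : ∀ i, 1 ≤ P i) (hp : 1 / p = ∑ i, 1 / P i)
    (hw : IsMultipleWeight P p w) (hw' : ∀ i, IsAInfty (w i)) (hκ₀ : 0 < κ) (hκ₁ : κ < 1) :
    ExtendsByTruncation Q (fun i => lebesgueClass (P i) (w i))
      (fun i => morreyClass (P i) κ (w i)) where
  aestronglyMeasurable i f hf := hf.1
  indicator_mem i f hf S hS := indicator_mem_morreyClass hf hS
  indicator_mem_of_mem i f hf S hS := indicator_mem_lebesgueClass hf hS
  indicator_mem_of_subset i f hf S hS c r hr hsub :=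
    indicator_mem_lebesgueClass_of_mem_morreyClass (hP i) hκ₀ (hw.1 i) hf hS hr hsub
  integrable f hf c r hr := by
    obtain ⟨C, hC, h⟩ := exists_lintegral_integrand_sub_le hn hm hQ hP hp hw hw' hκ₀ hκ₁
    have hp0 := exponent_pos hm hP hp
    have hmeas := ((aestronglyMeasurable_integrand hQmeas fun i => (hf i).1).sub
      (aestronglyMeasurable_integrand hQmeas fun i =>
        (hf i).1.indicator (measurableSet_ball (x := c) (ε := 2 * r)))).prodMk_left
    filter_upwards [hmeas] with x hx hxb
    refine ⟨hx, (h f (fun i => (hf i).1) c r hr x hxb).trans_lt ?_⟩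
    refine ENNReal.mul_lt_top (ENNReal.mul_lt_top hC.lt_top ?_)
      (ENNReal.prod_lt_top fun i _ => (hf i).2)
    exact (ENNReal.rpow_ne_top_of_nonneg'
      (pos_iff_ne_zero.2 (wMeasure_nuWeight_ball_ne_zero hp0 hP hw.1 c hr))
      (hw.wMeasure_nuWeight_ball_ne_top hp0 hP c hr)).lt_top

theorem exists_prod_eLpNorm_truncate_le (hm : 0 < m) (hP : ∀ i, 1 ≤ P i)
    (hp : 1 / p = ∑ i, 1 / P i) (hw : IsMultipleWeight P p w) (hw' : ∀ i, IsAInfty (w i))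
    (hκ : 0 < κ) :
    ∃ C : ℝ≥0∞, C ≠ ∞ ∧ ∀ (f : Fin m → E n → ℂ) (c : E n) (r : ℝ), 0 < r →
      ∏ i, eLpNorm (truncate (Metric.ball c (2 * r)) f i) (ENNReal.ofReal (P i))
          (wMeasure (w i)) ≤
        C * wMeasure (nuWeight P p w) (Metric.ball c r) ^ (κ / p) *
          ∏ i, morreyNorm (P i) κ (w i) (f i) := by
  have hp0 := exponent_pos hm hP hp
  have hκp : 0 ≤ κ / p := by positivity
  obtain ⟨C, hC, h⟩ := exists_prod_eLpNorm_ball_le hm hP hp hw.1 hw' hκ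
  obtain ⟨D, hD, hdoub⟩ := hw.exists_doubling hp0 hP
  refine ⟨C * D ^ (κ / p), ENNReal.mul_ne_top hC (ENNReal.rpow_ne_top_of_nonneg hκp hD),
    fun f c r hr => ?_⟩
  simp only [truncate, eLpNorm_indicator_eq_eLpNorm_restrict measurableSet_ball]
  refine (h f c (2 * r) (by positivity)).trans ?_
  rw [mul_assoc C (D ^ _), ← ENNReal.mul_rpow_of_nonneg _ _ hκp]
  gcongr
  exact (measure_mono (Metric.ball_subset_ball (by linarith))).trans
    (hdoub c c r hr (Metric.ball_subset_ball (by linarith)))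

/-- Compare `t / 2` with `M`. If `t / 2 ≤ M`, the whole measure of `S` is an adequate bound;
otherwise `‖g‖ > t` forces `‖h‖ > t / 2`. -/
theorem weakLpNorm_le_of_ae_enorm_le {Y Z : Type*} [NormedAddCommGroup Y] [NormedAddCommGroup Z]
    (hp : 0 < p) {μ : Measure (E n)} {S : Set (E n)} {g : E n → Y} {h : E n → Z} {M : ℝ≥0∞}
    (hgh : ∀ᵐ x ∂μ.restrict S, ‖g x‖ₑ ≤ ‖h x‖ₑ + M) :
    weakLpNorm p g (μ.restrict S) ≤ 2 * (weakLpNorm p h μ + M * μ S ^ (1 / p)) := by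
  have hp' : 0 ≤ 1 / p := by positivity
  refine iSup_le fun t => ?_
  have ht2 : (t : ℝ≥0∞) = 2 * ((t / 2 : ℝ≥0) : ℝ≥0∞) := by
    rw [← ENNReal.coe_ofNat, ← ENNReal.coe_mul]
    congr 1
    field_simp
  rcases le_or_gt ((t / 2 : ℝ≥0) : ℝ≥0∞) M with hM | hM
  · rw [ht2, mul_assoc]
    gcongr
    refine le_trans ?_ le_add_self
    refine mul_le_mul' hM (ENNReal.rpow_le_rpow ?_ hp')
    exact (measure_mono (Set.subset_univ _)).trans_eq (Measure.restrict_apply_univ S)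
  · rw [ht2, mul_assoc, ← ht2]
    gcongr
    refine le_trans ?_ le_self_add
    refine le_trans ?_ (le_iSup _ (t / 2))
    refine mul_le_mul' le_rfl (ENNReal.rpow_le_rpow ?_ hp')
    refine (measure_mono_ae ?_).trans (Measure.restrict_apply_le S _)
    filter_upwards [hgh] with x hx (hlt : _ < _)
    change _ < _
    by_contra hle
    have := hlt.trans_le (hx.trans (add_le_add (not_lt.1 hle) hM.le))
    rw [← two_mul, ← ht2] at this
    exact lt_irrefl _ this

theorem rpow_neg_mul_rpow_mul_cancel {N : ℝ≥0∞} (h0 : N ≠ 0) (h1 : N ≠ ∞) (a : ℝ) (b : ℝ≥0∞) :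
    N ^ (-a) * (N ^ a * b) = b := by
  rw [← mul_assoc, ← ENNReal.rpow_add _ _ h0 h1, neg_add_cancel, ENNReal.rpow_zero, one_mul]

theorem exists_morreyNorm_extension_le (hn : 0 < n) (hm : 0 < m)
    (hQmeas : AEStronglyMeasurable (fun z : E n × (Fin m → E n) => Q z.1 z.2) volume)
    (hQ : SizeCondition Q) (hP : ∀ i, 1 ≤ P i) (hp : 1 / p = ∑ i, 1 / P i)
    (hw : IsMultipleWeight P p w) (hw' : ∀ i, IsAInfty (w i)) (hκ₀ : 0 < κ) (hκ₁ : κ < 1)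
    (hT : IsKernelOperator Q (fun i => lebesgueClass (P i) (w i)) T)
    {A : ℝ≥0} (hA : ∀ f, (∀ i, f i ∈ lebesgueClass (P i) (w i)) →
      eLpNorm (fun x => ‖T f x‖) (ENNReal.ofReal p) (wMeasure (nuWeight P p w)) ≤
        A * ∏ i, eLpNorm (f i) (ENNReal.ofReal (P i)) (wMeasure (w i))) :
    ∃ C : ℝ≥0, ∀ f, (∀ i, f i ∈ morreyClass (P i) κ (w i)) →
      morreyNorm p κ (nuWeight P p w) (fun x => ‖extension Q T f x‖) ≤
        C * ∏ i, morreyNorm (P i) κ (w i) (f i) := by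
  have hp0 := exponent_pos hm hP hp
  have hext := extendsByTruncation_morreyClass hn hm hQmeas hQ hP hp hw hw' hκ₀ hκ₁
  obtain ⟨C₁, hC₁, h₁⟩ := exists_prod_eLpNorm_truncate_le hm hP hp hw hw' hκ₀
  obtain ⟨C₂, hC₂, h₂⟩ := exists_lintegral_integrand_sub_le hn hm hQ hP hp hw hw' hκ₀ hκ₁
  -- The exponent `p` may be smaller than one, where only a quasi-triangle inequality holds.
  set K : ℝ≥0∞ := ENNReal.LpAddConst (ENNReal.ofReal p)
  have hK : K ≠ ∞ := (ENNReal.LpAddConst_lt_top _).ne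
  have hC : K * (A * C₁ + C₂) ≠ ∞ := ENNReal.mul_ne_top hK
    (ENNReal.add_ne_top.2 ⟨ENNReal.mul_ne_top ENNReal.coe_ne_top hC₁, hC₂⟩)
  refine ⟨(K * (A * C₁ + C₂)).toNNReal, fun f hf => ?_⟩
  rw [ENNReal.coe_toNNReal hC]
  refine iSup_le fun c => iSup_le fun r => iSup_le fun hr => ?_
  have h2r : 0 < 2 * r := by positivity
  have hN0 := wMeasure_nuWeight_ball_ne_zero hp0 hP hw.1 c hr
  have hN1 := hw.wMeasure_nuWeight_ball_ne_top hp0 hP c hr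
  have hfm : ∀ i, AEStronglyMeasurable (f i) volume := fun i => (hf i).1
  set S := Metric.ball c (2 * r)
  set ν := wMeasure (nuWeight P p w)
  set N := ν (Metric.ball c r) with hN
  set M := ∏ i, morreyNorm (P i) κ (w i) (f i)
  have hac : ν.restrict (Metric.ball c r) ≪ volume :=
    Measure.restrict_le_self.absolutelyContinuous.trans (wMeasure_absolutelyContinuous _)
  have heq : extension Q T f =ᵐ[ν.restrict (Metric.ball c r)]
      T (truncate S f) + fun x => ∫ y, (integrand Q f x y - integrand Q (truncate S f) x y) := by
    have := (wMeasure_absolutelyContinuous (nuWeight P p w)).ae_le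
      (hext.extension_ae_eq_localExtension hT hf c hr)
    exact (ae_restrict_iff' measurableSet_ball).2 this
  have hfD := hext.truncate_ball_mem hf c h2r
  have hloc : eLpNorm (T (truncate S f)) (ENNReal.ofReal p) (ν.restrict (Metric.ball c r)) ≤
      N ^ (κ / p) * (A * C₁ * M) := by
    refine (eLpNorm_mono_measure _ Measure.restrict_le_self).trans ?_
    rw [← eLpNorm_norm]
    refine (hA _ hfD).trans ((mul_le_mul_right (h₁ f c r hr) _).trans_eq ?_)
    ring
  have htail : eLpNorm (fun x => ∫ y, (integrand Q f x y - integrand Q (truncate S f) x y))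
      (ENNReal.ofReal p) (ν.restrict (Metric.ball c r)) ≤ N ^ (κ / p) * (C₂ * M) := by
    refine (eLpNorm_le_of_ae_enorm_bound (C := C₂ * N ^ ((κ - 1) / p) * M)
      ((ae_restrict_iff' measurableSet_ball).2 (Filter.Eventually.of_forall fun x hx =>
        (enorm_integral_le_lintegral_enorm _).trans (h₂ f hfm c r hr x hx)))).trans_eq ?_
    -- The uniform tail bound costs `N ^ (1 / p)` when integrated over the ball, bringing the
    -- exponent from `(κ - 1) / p` up to `κ / p`.
    rw [Measure.restrict_apply_univ, ENNReal.toReal_ofReal hp0.le, ← hN,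
      show κ / p = p⁻¹ + (κ - 1) / p by ring, ENNReal.rpow_add _ _ hN0 hN1, smul_eq_mul]
    ring
  rw [eLpNorm_norm, eLpNorm_congr_ae heq, neg_div]
  calc _ ≤ N ^ (-(κ / p)) * (K * (N ^ (κ / p) * (A * C₁ * M) + N ^ (κ / p) * (C₂ * M))) := by
        gcongr
        refine (eLpNorm_add_le' ((hT.aestronglyMeasurable _ hfD).mono_ac hac)
          ((aestronglyMeasurable_integral_sub_truncate hQmeas hfm measurableSet_ball).mono_ac hac)
          _).trans ?_
        gcongr
    _ = N ^ (-(κ / p)) * (N ^ (κ / p) * (K * (A * C₁ + C₂) * M)) := by ring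
    _ = _ := rpow_neg_mul_rpow_mul_cancel hN0 hN1 _ _

theorem exists_weakMorreyNorm_extension_le (hn : 0 < n) (hm : 0 < m)
    (hQmeas : AEStronglyMeasurable (fun z : E n × (Fin m → E n) => Q z.1 z.2) volume)
    (hQ : SizeCondition Q) (hP : ∀ i, 1 ≤ P i) (hp : 1 / p = ∑ i, 1 / P i)
    (hw : IsMultipleWeight P p w) (hw' : ∀ i, IsAInfty (w i)) (hκ₀ : 0 < κ) (hκ₁ : κ < 1)
    (hT : IsKernelOperator Q (fun i => lebesgueClass (P i) (w i)) T)
    {A : ℝ≥0} (hA : ∀ f, (∀ i, f i ∈ lebesgueClass (P i) (w i)) →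
      weakLpNorm p (fun x => ‖T f x‖) (wMeasure (nuWeight P p w)) ≤
        A * ∏ i, eLpNorm (f i) (ENNReal.ofReal (P i)) (wMeasure (w i))) :
    ∃ C : ℝ≥0, ∀ f, (∀ i, f i ∈ morreyClass (P i) κ (w i)) →
      weakMorreyNorm p κ (nuWeight P p w) (fun x => ‖extension Q T f x‖) ≤
        C * ∏ i, morreyNorm (P i) κ (w i) (f i) := by
  have hp0 := exponent_pos hm hP hp
  have hext := extendsByTruncation_morreyClass hn hm hQmeas hQ hP hp hw hw' hκ₀ hκ₁
  obtain ⟨C₁, hC₁, h₁⟩ := exists_prod_eLpNorm_truncate_le hm hP hp hw hw' hκ₀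
  obtain ⟨C₂, hC₂, h₂⟩ := exists_lintegral_integrand_sub_le hn hm hQ hP hp hw hw' hκ₀ hκ₁
  have hC : 2 * (A * C₁ + C₂) ≠ ∞ := ENNReal.mul_ne_top ENNReal.ofNat_ne_top
    (ENNReal.add_ne_top.2 ⟨ENNReal.mul_ne_top ENNReal.coe_ne_top hC₁, hC₂⟩)
  refine ⟨(2 * (A * C₁ + C₂)).toNNReal, fun f hf => ?_⟩
  rw [ENNReal.coe_toNNReal hC]
  refine iSup_le fun c => iSup_le fun r => iSup_le fun hr => ?_
  have hN0 := wMeasure_nuWeight_ball_ne_zero hp0 hP hw.1 c hr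
  have hN1 := hw.wMeasure_nuWeight_ball_ne_top hp0 hP c hr
  have hfm : ∀ i, AEStronglyMeasurable (f i) volume := fun i => (hf i).1
  set S := Metric.ball c (2 * r)
  set ν := wMeasure (nuWeight P p w)
  set N := ν (Metric.ball c r) with hN
  set M := ∏ i, morreyNorm (P i) κ (w i) (f i)
  -- On the ball the tail is a constant perturbation of the local part, as
  -- `weakLpNorm_le_of_ae_enorm_le` requires.
  have hbound : ∀ᵐ x ∂ν.restrict (Metric.ball c r), ‖‖extension Q T f x‖‖ₑ ≤
      ‖‖T (truncate S f) x‖‖ₑ + C₂ * N ^ ((κ - 1) / p) * M := by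
    rw [ae_restrict_iff' measurableSet_ball]
    filter_upwards [(wMeasure_absolutelyContinuous (nuWeight P p w)).ae_le
      (hext.extension_ae_eq_localExtension hT hf c hr)] with x hx hxb
    rw [enorm_norm, enorm_norm, hx hxb, localExtension]
    refine (enorm_add_le _ _).trans ?_
    gcongr
    exact (enorm_integral_le_lintegral_enorm _).trans (h₂ f hfm c r hr x hxb)
  have hfD := hext.truncate_ball_mem hf c (r := 2 * r) (by positivity)
  have hloc : weakLpNorm p (fun x => ‖T (truncate S f) x‖) ν ≤ N ^ (κ / p) * (A * C₁ * M) := by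
    refine (hA _ hfD).trans ((mul_le_mul_right (h₁ f c r hr) _).trans_eq ?_)
    ring
  have htail : C₂ * N ^ ((κ - 1) / p) * M * N ^ (1 / p) = N ^ (κ / p) * (C₂ * M) := by
    rw [show κ / p = (κ - 1) / p + 1 / p by ring, ENNReal.rpow_add _ _ hN0 hN1]
    ring
  rw [neg_div]
  calc _ ≤ N ^ (-(κ / p)) * (2 * (N ^ (κ / p) * (A * C₁ * M) + N ^ (κ / p) * (C₂ * M))) := by
        gcongr
        refine (weakLpNorm_le_of_ae_enorm_le hp0 hbound).trans ?_
        rw [← hN, htail]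
        gcongr
    _ = N ^ (-(κ / p)) * (N ^ (κ / p) * (2 * (A * C₁ + C₂) * M)) := by ring
    _ = _ := rpow_neg_mul_rpow_mul_cancel hN0 hN1 _ _

end Main

end MorreyMultilinear

end

theorem theorem1 {n m : ℕ} (hn : 0 < n) (hm : 0 < m)
    {X : Type*} [NormedAddCommGroup X] [NormedSpace ℂ X] [CompleteSpace X]
    (Q : MorreyMultilinear.E n → (Fin m → MorreyMultilinear.E n) → (ℂ →L[ℂ] X))
    (hQmeas : AEStronglyMeasurable
      (fun z : MorreyMultilinear.E n × (Fin m → MorreyMultilinear.E n) => Q z.1 z.2) volume)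
    (hQ : MorreyMultilinear.SizeCondition Q)
    (P : Fin m → ℝ) (hP : ∀ i, 1 ≤ P i) (p : ℝ) (hp : 1 / p = ∑ i, 1 / P i)
    (w : Fin m → MorreyMultilinear.E n → ℝ)
    (hw : MorreyMultilinear.IsMultipleWeight P p w)
    (hw' : ∀ i, MorreyMultilinear.IsAInfty (w i))
    (T : (Fin m → MorreyMultilinear.E n → ℂ) → MorreyMultilinear.E n → X)
    (hT : MorreyMultilinear.IsKernelOperator Q
      (fun i => MorreyMultilinear.lebesgueClass (P i) (w i)) T)
    (κ : ℝ) (hκ₀ : 0 < κ) (hκ₁ : κ < 1) :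
    ∃ T' : (Fin m → MorreyMultilinear.E n → ℂ) → MorreyMultilinear.E n → X,
      -- `T'` is the extension of `T` to the product of the Morrey spaces, and it is unique
      MorreyMultilinear.IsKernelExtension Q
        (fun i => MorreyMultilinear.lebesgueClass (P i) (w i))
        (fun i => MorreyMultilinear.morreyClass (P i) κ (w i)) T T' ∧
      (∀ T'', MorreyMultilinear.IsKernelExtension Q
          (fun i => MorreyMultilinear.lebesgueClass (P i) (w i))
          (fun i => MorreyMultilinear.morreyClass (P i) κ (w i)) T T'' →
        ∀ f, (∀ i, f i ∈ MorreyMultilinear.morreyClass (P i) κ (w i)) →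
          T'' f =ᵐ[volume] T' f) ∧
      -- if `T` is given everywhere by the convergent integral, then so is `T'`
      (MorreyMultilinear.IsIntegralOperator Q
          (fun i => MorreyMultilinear.lebesgueClass (P i) (w i)) T →
        MorreyMultilinear.IsIntegralOperator Q
          (fun i => MorreyMultilinear.morreyClass (P i) κ (w i)) T') ∧
      -- (i)
      ((∀ i, 1 < P i) →
        (∃ A : ℝ≥0, ∀ f, (∀ i, f i ∈ MorreyMultilinear.lebesgueClass (P i) (w i)) →
          eLpNorm (fun x => ‖T f x‖) (ENNReal.ofReal p)
              (MorreyMultilinear.wMeasure (MorreyMultilinear.nuWeight P p w)) ≤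
            A * ∏ i, eLpNorm (f i) (ENNReal.ofReal (P i)) (MorreyMultilinear.wMeasure (w i))) →
        ∃ C : ℝ≥0, ∀ f, (∀ i, f i ∈ MorreyMultilinear.morreyClass (P i) κ (w i)) →
          MorreyMultilinear.morreyNorm p κ (MorreyMultilinear.nuWeight P p w)
              (fun x => ‖T' f x‖) ≤
            C * ∏ i, MorreyMultilinear.morreyNorm (P i) κ (w i) (f i)) ∧
      -- (ii)
      ((∃ i, P i = 1) →
        (∃ A : ℝ≥0, ∀ f, (∀ i, f i ∈ MorreyMultilinear.lebesgueClass (P i) (w i)) →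
          MorreyMultilinear.weakLpNorm p (fun x => ‖T f x‖)
              (MorreyMultilinear.wMeasure (MorreyMultilinear.nuWeight P p w)) ≤
            A * ∏ i, eLpNorm (f i) (ENNReal.ofReal (P i)) (MorreyMultilinear.wMeasure (w i))) →
        ∃ C : ℝ≥0, ∀ f, (∀ i, f i ∈ MorreyMultilinear.morreyClass (P i) κ (w i)) →
          MorreyMultilinear.weakMorreyNorm p κ (MorreyMultilinear.nuWeight P p w)
              (fun x => ‖T' f x‖) ≤
            C * ∏ i, MorreyMultilinear.morreyNorm (P i) κ (w i) (f i)) := by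
  have hext := MorreyMultilinear.extendsByTruncation_morreyClass hn hm hQmeas hQ hP hp hw hw'
    hκ₀ hκ₁
  refine ⟨MorreyMultilinear.extension Q T, hext.isKernelExtension_extension hT hQmeas,
    fun T'' hT'' f hf => hext.ae_eq_extension hT'' hf, hext.isIntegralOperator_extension,
    fun _ ⟨_, hA⟩ => ?_, fun _ ⟨_, hA⟩ => ?_⟩
  · exact MorreyMultilinear.exists_morreyNorm_extension_le hn hm hQmeas hQ hP hp hw hw' hκ₀ hκ₁
      hT hA
  · exact MorreyMultilinear.exists_weakMorreyNorm_extension_le hn hm hQmeas hQ hP hp hw hw' hκ₀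
      hκ₁ hT hA
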